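/- \textbf{Definitions.} A \emph{(disjunctive) program} $\Pi$ is a finite set of rules $r$ of the form $a_1\vee\cdots\vee a_\ell \leftarrow a_{\ell+1},\ldots,a_m,\neg a_{m+1},\ldots,\neg a_n$ with $0\le\ell\le m\le n$ and distinct atoms $a_1,\ldots,a_n$; let $H_r=\{a_1,\ldots,a_\ell\}$, $B_r^+=\{a_{\ell+1},\ldots,a_m\}$, $B_r^-=\{a_{m+1},\ldots,a_n\}$, $\mathrm{at}(r)=H_r\cup B_r^+\cup B_r^-$ and $\mathrm{at}(\Pi)=\bigcup_{r\in\Pi}\mathrm{at}(r)$. A set $I$ of atoms is a model of $\Pi$ if for every $r\in\Pi$ we have $(H_r\cup B_r^-)\cap I\neq\emptyset$ or $B_r^+\setminus I\neq\emptyset$. The reduct $\Pi^I$ is obtained from $\Pi$ by removing all rules $r$ with $B_r^-\cap I\ne\emptyset$ and then removing the negated atoms from the remaining rules. $I$ is an \emph{answer set} of $\Pi$ if it is a $\subseteq$-minimal model of $\Pi^I$, and $\Pi$ is \emph{consistent} if it has an answer set. The \emph{incidence graph} $\mathcal I_\Pi$ has the atoms and the rules of $\Pi$ as vertices and an edge $\{a,r\}$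 whenever $r\in\Pi$ and $a\in\mathrm{at}(r)$. The \emph{treedepth} of a finite graph $G=(V,E)$ is the least height (number of edges on a longest path starting in the root) of a rooted tree on $V$ in which, for every $\{u,v\}\in E$, one of $u,v$ is an ancestor of the other (and $0$ if $V=\emptyset$). The \emph{Exponential Time Hypothesis} (ETH) states that there is a $\delta>0$ such that no algorithm decides satisfiability of $3$-CNF formulas $F$ (clauses with at most three literals) in time $2^{\delta n}\cdot\mathrm{poly}(|F|)$, where $n$ is the number of variables and $|F|$ the input length. Algorithms are multi-stack (equivalently, up to polynomial factors, multi-tape) Turing machines. Inputs are words that list the clauses of $F$, respectively the rules of $\Pi$, without repetition and in any order, where the $N$ variables (atoms) that occur are numbered $0,\ldots,N-1$ and a number is written in unary; since all $N$ numbers occur, this is polynomially related to a binary encoding. \textbf{Theorem.} Assume ETH. Then consistency of disjunctive programs cannot be decided in time $2^{2^{o(k)}}\cdot\mathrm{poly}(|\mathrm{at}(\Pi)|)$, where $k$ is the treedepth of $\mathcal I_\Pi$. That is, there are no function $f:\mathbb N\to\mathbb R$ with $f(k)\in o(k)$, polynomial $p$, and algorithm that, on every disjunctive program $\Pi$, correctly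 decides whether $\Pi$ is consistent in at most $2^{2^{f(k)}}\cdot p(|\mathrm{at}(\Pi)|)$ steps, where $k$ is the treedepth of $\mathcal I_\Pi$. -/

import Mathlib

/-! ### Disjunctive logic programs -/

namespace DisjASP

/-- A rule `a₁ ∨ ⋯ ∨ a_l ← a_{l+1}, …, a_m, ¬a_{m+1}, …, ¬a_n` over distinct atoms. Atoms are
natural numbers. -/
@[ext]
structure Rule where
  head : Finset ℕ
  pos : Finset ℕ
  neg : Finset ℕ
  head_pos : Disjoint head pos
  head_neg : Disjoint head neg
  pos_neg : Disjoint pos neg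
  deriving DecidableEq

/-- The atoms of a rule. -/
def Rule.atoms (r : Rule) : Finset ℕ := r.head ∪ r.pos ∪ r.neg

/-- The interpretation `I` satisfies the rule `r`. -/
def Rule.SatisfiedBy (r : Rule) (I : Finset ℕ) : Prop :=
  ((r.head ∪ r.neg) ∩ I).Nonempty ∨ (r.pos \ I).Nonempty

/-- The rule without its negative body. -/
def Rule.dropNeg (r : Rule) : Rule where
  head := r.head
  pos := r.pos
  neg := ∅
  head_pos := r.head_pos
  head_neg := Finset.disjoint_empty_right _
  pos_neg := Finset.disjoint_empty_right _

/-- A (finite, disjunctive) program is a set of rules. -/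
abbrev Program := Finset Rule

namespace Program

/-- The atoms of a program. -/
def atoms (P : Program) : Finset ℕ := P.biUnion Rule.atoms

/-- The interpretation `I` is a model of `P`. -/
def HasModel (P : Program) (I : Finset ℕ) : Prop := ∀ r ∈ P, r.SatisfiedBy I

/-- The Gelfond-Lifschitz reduct of `P` under `I`. -/
def reduct (P : Program) (I : Finset ℕ) : Program :=
  (P.filter fun r => Disjoint r.neg I).image Rule.dropNeg

/-- `I` is an answer set of `P`: a subset-minimal model of the reduct of `P` under `I`. -/
def IsAnswerSet (P : Program) (I : Finset ℕ) : Prop := Minimal (P.reduct I).HasModel I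

/-- A program is consistent if it has an answer set. -/
def Consistent (P : Program) : Prop := ∃ I, P.IsAnswerSet I

/-- The incidence graph: its vertices are the atoms and the rules of `P`, and an atom is adjacent
to the rules in which it occurs. -/
def incidenceGraph (P : Program) : SimpleGraph ({a // a ∈ P.atoms} ⊕ {r // r ∈ P}) where
  Adj
    | .inl a, .inr r => a.1 ∈ r.1.atoms
    | .inr r, .inl a => a.1 ∈ r.1.atoms
    | _, _ => False
  symm := ⟨by rintro (a | r) (b | s) h <;> exact h⟩
  loopless := ⟨by rintro (a | r) h <;> exact h⟩

end Program

/-! ### Treedepth -/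

/-- The rooted tree `T`, whose nodes are identified with the vertices of `G` through `e`, is a
Trémaux tree of `G`: the ends of every edge are related by ancestry. (In a `RootedTree`, `x ≤ y`
says that `x` is an ancestor of `y`, or `y` itself.) -/
def IsTremauxTree {V : Type*} (G : SimpleGraph V) (T : RootedTree) (e : V ≃ T) : Prop :=
  ∀ u v, G.Adj u v → e u ≤ e v ∨ e v ≤ e u

/-- The treedepth of a finite graph: the least height of a Trémaux tree, where the height of a
rooted tree is the largest number of edges on a path that starts in the root. (The graph without
vertices gets the value `0`.) -/
noncomputable def treedepth {V : Type} (G : SimpleGraph V) : ℕ :=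
  sInf {h : ℕ | ∃ (T : RootedTree.{0}) (e : V ≃ T),
    IsTremauxTree G T e ∧ ∀ x : T, Order.height x ≤ (h : ℕ∞)}

/-! ### Decision algorithms and their running time -/

/-- Some multi-stack Turing machine solves the following decision problem: the instances are the
`a : α`, the word `w` over the alphabet `Γ` is a representation of the instance `a` if `Enc a w`,
and the answer is whether `P a`. On every representation `w` of every instance `a`, the machine
halts after at most `T a w` steps with the correct answer as its output. -/
def SolvableInTime {α Γ : Type} (Enc : α → List Γ → Prop) (P : α → Prop) (T : α → List Γ → ℝ) :
    Prop :=
  ∃ M : Turing.TM2ComputableAux Γ Bool, ∀ a w, Enc a w →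
    ∃ (b : Bool) (t : ℕ), (b = true ↔ P a) ∧ (t : ℝ) ≤ T a w ∧
      Nonempty (Turing.TM2OutputsInTime M.tm (w.map M.inputAlphabet.symm)
        (some [M.outputAlphabet.symm b]) t)

/-! ### Programs as words -/

/-- The alphabet for programs. -/
inductive ProgramSymbol
  | tick
  | atom
  | bar
  deriving DecidableEq

/-- A list of atoms as a word; the atom `a` is written as `a` ticks and an end mark. -/
def atomsWord (l : List ℕ) : List ProgramSymbol :=
  l.flatMap fun a => List.replicate a .tick ++ [.atom]

/-- The word `w` represents the rule `r`: it lists, each without repetition, the head, the positive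
body and the negative body of `r`, and each of these lists is followed by a bar. -/
def Rule.EncodedBy (r : Rule) (w : List ProgramSymbol) : Prop :=
  ∃ h p n : List ℕ, (h : Multiset ℕ) = r.head.val ∧ (p : Multiset ℕ) = r.pos.val ∧
    (n : Multiset ℕ) = r.neg.val ∧
    w = atomsWord h ++ [.bar] ++ atomsWord p ++ [.bar] ++ atomsWord n ++ [.bar]

/-- The word `w` represents the program `P`: the atoms that occur in `P` are numbered
`0, …, |at(P)| - 1`, and `w` lists the rules of `P`, in some order and without repetition. -/
def Program.EncodedBy (P : Program) (w : List ProgramSymbol) : Prop :=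
  P.atoms = Finset.range P.atoms.card ∧
    ∃ (rs : List Rule) (ws : List (List ProgramSymbol)), (rs : Multiset Rule) = P.val ∧
      List.Forall₂ Rule.EncodedBy rs ws ∧ w = ws.flatten

/-! ### 3-SAT and the Exponential Time Hypothesis -/

/-- A literal: a variable and its sign (`true` for the variable, `false` for its negation). -/
abbrev Literal := ℕ × Bool

/-- A formula in conjunctive normal form: a set of clauses, which are sets of literals. -/
abbrev CNF := Finset (Finset Literal)

namespace CNF

/-- The variables of a formula. -/
def vars (F : CNF) : Finset ℕ := F.biUnion fun c => c.image Prod.fst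

/-- Every clause has at most three literals. -/
def Is3CNF (F : CNF) : Prop := ∀ c ∈ F, c.card ≤ 3

/-- The formula has a satisfying assignment. -/
def Satisfiable (F : CNF) : Prop := ∃ τ : ℕ → Bool, ∀ c ∈ F, ∃ l ∈ c, τ l.1 = l.2

end CNF

/-- The alphabet for formulas. -/
inductive CNFSymbol
  | tick
  | pos
  | neg
  | bar
  deriving DecidableEq

/-- A list of literals as a word; a literal of the variable `x` is written as `x` ticks, followed by
its sign. -/
def literalsWord (l : List Literal) : List CNFSymbol :=
  l.flatMap fun x => List.replicate x.1 .tick ++ [if x.2 then .pos else .neg]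

/-- The word `w` represents the clause `c`: it lists the literals of `c` without repetition and ends
in a bar. -/
def ClauseEncodedBy (c : Finset Literal) (w : List CNFSymbol) : Prop :=
  ∃ l : List Literal, (l : Multiset Literal) = c.val ∧ w = literalsWord l ++ [.bar]

/-- The word `w` represents the 3-CNF formula `F`: the variables that occur in `F` are numbered
`0, …, |var(F)| - 1`, and `w` lists the clauses of `F`, in some order and without repetition. -/
def CNF.EncodedAs3CNF (F : CNF) (w : List CNFSymbol) : Prop :=
  F.Is3CNF ∧ F.vars = Finset.range F.vars.card ∧
    ∃ (cs : List (Finset Literal)) (ws : List (List CNFSymbol)),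
      (cs : Multiset (Finset Literal)) = F.val ∧
      List.Forall₂ ClauseEncodedBy cs ws ∧ w = ws.flatten

/-- The Exponential Time Hypothesis: there is a `δ > 0` such that the satisfiability of 3-CNF
formulas with `n` variables cannot be decided in time `2 ^ (δ n)` times a polynomial in the length
of the input. -/
def ETH : Prop :=
  ∃ δ : ℝ, 0 < δ ∧ ¬ ∃ p : Polynomial ℕ,
    SolvableInTime CNF.EncodedAs3CNF CNF.Satisfiable
      fun F w => (2 : ℝ) ^ (δ * (F.vars.card : ℝ)) * (p.eval w.length : ℕ)

end DisjASP

/-! The proof reduces 3-SAT with `n` variables to consistency of programs whose treedepth is only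
logarithmic in `n`. Clauses are numbered by codes of `L` bits. The program guesses an assignment by
one disjunction per variable and quantifies universally over clause numbers by saturation: each bit
is a disjunction of two atoms, the atom `0` forces both atoms of every bit, and a constraint demands
`0`. The atom `0` is derivable from the code of a clause together with a true literal of that
clause, and from every unused code. An answer set therefore contains `0` and all bit atoms, and it
is minimal exactly if no choice of bits gets by without `0`, that is, if the guessed assignment
makes a literal true in every clause (`satisfiable_of_consistent`, `consistent_of_satisfiable`).

A rule mentions `0`, bit atoms and the two atoms of at most one variable. A path through `0` and the
bit atoms, with a short branch for each variable below it, is thus the trunk of a Trémaux tree, and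
the treedepth is at most `2 * L + 3` (`treedepth_cnfProgram_le`). A 3-CNF without repeated clauses
has `O(n ^ 3)` clauses and a word of length `O(n ^ 4)`, so `2 ^ L` can be kept polynomial in `n`.
Then `f(k) ∈ o(k)` makes `2 ^ f(k)` smaller than `δ * n` up to a constant (`exists_exponent_bound`),
which contradicts ETH.

Since time is measured on Turing machines, the reduction is a command of a small while language. It
is compiled step by step (`Cmd.Exec.iterate_step`), put in front of the assumed machine
(`SolvableInTime.of_exec`), and shown to take cubic time (`runs_translateCNF`). It never computes
`n`: the length `B` of the input serves both to choose `L` and as the number of guessed variables.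
Surplus variables neither affect consistency nor raise the treedepth bound. -/

open Turing StateTransition DisjASP

/-! ### A while language over stacks -/

/-- Commands that work on stacks indexed by `K` over the alphabet `A`: `case k f` pops a symbol from
the stack `k` and branches on it, `loop k f` pops symbols `a` from the stack `k` and runs `f a` until
the stack is empty. -/
inductive Cmd (K A : Type)
  | skip
  | push (k : K) (a : A)
  | seq (c d : Cmd K A)
  | case (k : K) (f : Option A → Cmd K A)
  | loop (k : K) (f : A → Cmd K A)

/-- The alphabets of two machines side by side, where the first one uses `A` on all stacks. -/
abbrev sumAlphabet (K A : Type) {K₂ : Type} (Γ : K₂ → Type) : K ⊕ K₂ → Type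
  | .inl _ => A
  | .inr k => Γ k

namespace Cmd

variable {K A : Type}

/-- `Exec c s s' t`: the command `c` turns the stacks `s` into the stacks `s'` in `t` steps. -/
inductive Exec [DecidableEq K] : Cmd K A → (K → List A) → (K → List A) → ℕ → Prop
  | skip (s) : Exec .skip s s 1
  | push (k a s) : Exec (.push k a) s (Function.update s k (a :: s k)) 1
  | seq {c d s s' s'' t t'} : Exec c s s' t → Exec d s' s'' t' → Exec (.seq c d) s s'' (t + t')
  | case {k f s s' t} : Exec (f (s k).head?) (Function.update s k (s k).tail) s' t →
      Exec (.case k f) s s' (t + 1)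
  | loop_nil {k f s} : s k = [] → Exec (.loop k f) s s 1
  | loop_cons {k f s s' s'' a l t t'} : s k = a :: l →
      Exec (f a) (Function.update s k l) s' t → Exec (.loop k f) s' s'' t' →
      Exec (.loop k f) s s'' (t + t' + 1)

/-- The labels of the compiled command. -/
def Lab : Cmd K A → Type
  | skip => Unit
  | push _ _ => Unit
  | seq c d => c.Lab ⊕ d.Lab
  | case _ f => Option (Σ o, (f o).Lab)
  | loop _ f => Option (Σ a, (f a).Lab)

/-- The labels of a command form a finite type. -/
@[reducible]
noncomputable def Lab.fintype [Fintype A] : (c : Cmd K A) → Fintype c.Lab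
  | skip => inferInstanceAs (Fintype Unit)
  | push _ _ => inferInstanceAs (Fintype Unit)
  | seq c d =>
    letI := Lab.fintype c
    letI := Lab.fintype d
    inferInstanceAs (Fintype (c.Lab ⊕ d.Lab))
  | case _ f =>
    letI := fun o => Lab.fintype (f o)
    inferInstanceAs (Fintype (Option (Σ o, (f o).Lab)))
  | loop _ f =>
    letI := fun o => Lab.fintype (f o)
    inferInstanceAs (Fintype (Option (Σ a, (f a).Lab)))

/-- The label at which the execution of a command starts. -/
def entry : (c : Cmd K A) → c.Lab
  | skip => ()
  | push _ _ => ()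
  | seq c _ => Sum.inl c.entry
  | case _ _ => (none : Option _)
  | loop _ _ => (none : Option _)

/-- The statements of the compiled command, as a part of a larger machine with labels `L`, with
further stacks, and with a further component `S` of its state. -/
def code {K₂ : Type} {Γ : K₂ → Type} {L S : Type} :
    (c : Cmd K A) → (c.Lab → L) → L → c.Lab →
      TM2.Stmt (sumAlphabet K A Γ) L (Option A × S)
  | skip, _, exit => fun _ => .goto fun _ => exit
  | push k a, _, exit => fun _ => .push (.inl k) (fun _ => a) (.goto fun _ => exit)
  | seq c d, emb, exit => fun l => Sum.elim
      (c.code (fun l => emb (Sum.inl l : c.Lab ⊕ d.Lab)) (emb (Sum.inr d.entry : c.Lab ⊕ d.Lab)))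
      (d.code (fun l => emb (Sum.inr l : c.Lab ⊕ d.Lab)) exit) (l : c.Lab ⊕ d.Lab)
  | case k f, emb, exit => fun l => Option.elim (l : Option (Σ o, (f o).Lab))
      (.pop (.inl k) (fun v o => (o, v.2)) (.goto fun v =>
        emb (some ⟨v.1, (f v.1).entry⟩ : Option (Σ o, (f o).Lab))))
      (fun p => (f p.1).code (fun l => emb (some ⟨p.1, l⟩ : Option (Σ o, (f o).Lab))) exit p.2)
  | loop k f, emb, exit => fun l => Option.elim (l : Option (Σ a, (f a).Lab))
      (.pop (.inl k) (fun v o => (o, v.2)) (.goto fun v => v.1.elim exit fun a =>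
        emb (some ⟨a, (f a).entry⟩ : Option (Σ a, (f a).Lab))))
      (fun p => (f p.1).code (fun l => emb (some ⟨p.1, l⟩ : Option (Σ a, (f a).Lab)))
        (emb (none : Option (Σ a, (f a).Lab))) p.2)

end Cmd

/-- The stacks of two machines side by side. -/
def sumStacks {K K₂ A : Type} {Γ : K₂ → Type} (s : K → List A) (u : ∀ k, List (Γ k)) :
    ∀ k : K ⊕ K₂, List (sumAlphabet K A Γ k)
  | .inl k => s k
  | .inr k => u k

section

variable {K K₂ A : Type} {Γ : K₂ → Type} [DecidableEq K] [DecidableEq K₂]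
  (s : K → List A) (u : ∀ k, List (Γ k))

theorem update_sumStacks_inl (k : K) (l : List A) :
    Function.update (sumStacks s u) (Sum.inl k) l = sumStacks (Function.update s k l) u := by
  funext k'
  rcases k' with k' | k'
  · by_cases h : k' = k
    · subst h; simp [sumStacks]
    · rw [Function.update_of_ne (by simpa using h)]; simp [sumStacks, h]
  · rw [Function.update_of_ne (by simp)]; rfl

theorem update_sumStacks_inr (k : K₂) (l : List (Γ k)) :
    Function.update (sumStacks s u) (Sum.inr k) l = sumStacks s (Function.update u k l) := by
  funext k'
  rcases k' with k' | k'
  · rw [Function.update_of_ne (by simp)]; rfl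
  · by_cases h : k' = k
    · subst h; simp [sumStacks]
    · rw [Function.update_of_ne (by simpa using h)]; simp [sumStacks, h]

end

/-- Iterates of `flip bind f` are the form in which `EvalsTo` counts machine steps. -/
theorem iterate_bind_trans {σ : Type*} {f : σ → Option σ} {a b : σ} {c : Option σ} {m n : ℕ}
    (h₁ : (flip bind f)^[m] (some a) = some b) (h₂ : (flip bind f)^[n] (some b) = c) :
    (flip bind f)^[m + n] (some a) = c := by
  rw [Nat.add_comm, Function.iterate_add_apply, h₁, h₂]

theorem iterate_bind_succ {σ : Type*} {f : σ → Option σ} {a b : σ} {c : Option σ} {n : ℕ}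
    (h₁ : f a = some b) (h₂ : (flip bind f)^[n] (some b) = c) :
    (flip bind f)^[n + 1] (some a) = c := by
  rw [Function.iterate_succ_apply, ← h₂, ← h₁]; rfl

/-- Correctness of the compiler, with exact step counts, by induction on the execution. The exit
label varies because a first command exits into the second one and a loop body into the loop head.
The register only remembers the last popped symbol, so its final value is left open. -/
theorem Cmd.Exec.iterate_step {K K₂ A : Type} {Γ : K₂ → Type} [DecidableEq K] [DecidableEq K₂]
    {L S : Type} {m : L → TM2.Stmt (sumAlphabet K A Γ) L (Option A × S)}
    {c : Cmd K A} {s s' : K → List A} {t : ℕ} (h : c.Exec s s' t) (emb : c.Lab → L) (exit : L)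
    (hm : ∀ l, m (emb l) = c.code emb exit l) (v : Option A) (x : S) (u : ∀ k, List (Γ k)) :
    ∃ v', (flip bind (TM2.step m))^[t] (some ⟨some (emb c.entry), (v, x), sumStacks s u⟩) =
      some ⟨some exit, (v', x), sumStacks s' u⟩ := by
  induction h generalizing exit v with
  | skip s =>
    refine ⟨v, iterate_bind_succ (b := ⟨some exit, (v, x), sumStacks s u⟩) ?_ rfl⟩
    rw [TM2.step, hm]; rfl
  | push k a s =>
    refine ⟨v, iterate_bind_succ (n := 0) (b := ⟨some exit, (v, x), _⟩) ?_ rfl⟩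
    rw [TM2.step, hm, ← update_sumStacks_inl]; rfl
  | @seq c d s s' s'' t t' h₁ h₂ ih₁ ih₂ =>
    obtain ⟨v₁, hv₁⟩ := ih₁ (fun l => emb (Sum.inl l : c.Lab ⊕ d.Lab))
      (emb (Sum.inr d.entry : c.Lab ⊕ d.Lab)) (fun l => hm (Sum.inl l : c.Lab ⊕ d.Lab)) v
    obtain ⟨v₂, hv₂⟩ := ih₂ (fun l => emb (Sum.inr l : c.Lab ⊕ d.Lab)) exit
      (fun l => hm (Sum.inr l : c.Lab ⊕ d.Lab)) v₁
    exact ⟨v₂, iterate_bind_trans hv₁ hv₂⟩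
  | @case k f s s' t h ih =>
    obtain ⟨v', hv'⟩ := ih (fun l => emb (some ⟨_, l⟩ : Option (Σ o, (f o).Lab))) exit
      (fun l => hm (some ⟨_, l⟩ : Option (Σ o, (f o).Lab))) (s k).head?
    refine ⟨v', iterate_bind_succ ?_ hv'⟩
    rw [TM2.step, hm, ← update_sumStacks_inl]; rfl
  | @loop_nil k f s h =>
    refine ⟨none, iterate_bind_succ (n := 0) (b := ⟨some exit, (none, x), _⟩) ?_ rfl⟩
    -- Popping an empty stack still writes its tail `[]` back, so `s` is put in the form of an
    -- update.
    have h' : s = Function.update s k [] := by rw [← h, Function.update_eq_self]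
    rw [TM2.step, hm]
    conv_rhs => rw [h', ← update_sumStacks_inl]
    simp [Cmd.code, Cmd.entry, sumStacks, h]
  | @loop_cons k f s s' s'' a l t t' h h₁ h₂ ih₁ ih₂ =>
    obtain ⟨v₁, hv₁⟩ := ih₁ (fun l => emb (some ⟨_, l⟩ : Option (Σ a, (f a).Lab)))
      (emb (none : Option (Σ a, (f a).Lab)))
      (fun l => hm (some ⟨_, l⟩ : Option (Σ a, (f a).Lab))) (some a)
    obtain ⟨v₂, hv₂⟩ := ih₂ emb exit hm v₁
    refine ⟨v₂, iterate_bind_succ ?_ (iterate_bind_trans hv₁ hv₂)⟩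
    rw [TM2.step, hm, ← update_sumStacks_inl]
    simp [Cmd.code, Cmd.entry, sumStacks, h]

/-! ### Composition of a command with a machine -/

/-- A statement as a part of a larger machine. -/
def liftStmt {K K₂ A L : Type} {Γ : K₂ → Type} {Λ S : Type} (g : Λ → L) :
    TM2.Stmt Γ Λ S → TM2.Stmt (sumAlphabet K A Γ) L (Option A × S)
  | .push k f q => .push (.inr k) (fun v => f v.2) (liftStmt g q)
  | .peek k f q => .peek (.inr k) (fun v o => (v.1, f v.2 o)) (liftStmt g q)
  | .pop k f q => .pop (.inr k) (fun v o => (v.1, f v.2 o)) (liftStmt g q)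
  | .load f q => .load (fun v => (v.1, f v.2)) (liftStmt g q)
  | .branch f q₁ q₂ => .branch (fun v => f v.2) (liftStmt g q₁) (liftStmt g q₂)
  | .goto f => .goto fun v => g (f v.2)
  | .halt => .halt

/-- A configuration as a configuration of a larger machine. -/
def liftCfg {K K₂ A L : Type} {Γ : K₂ → Type} {Λ S : Type} (g : Λ → L) (v : Option A)
    (s : K → List A) (c : TM2.Cfg Γ Λ S) : TM2.Cfg (sumAlphabet K A Γ) L (Option A × S) :=
  ⟨c.l.map g, (v, c.var), sumStacks s c.stk⟩

section

variable {K K₂ A L : Type} {Γ : K₂ → Type} {Λ S : Type} [DecidableEq K] [DecidableEq K₂]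
  (g : Λ → L) (v : Option A) (s : K → List A)

theorem stepAux_liftStmt (q : TM2.Stmt Γ Λ S) (x : S) (u : ∀ k, List (Γ k)) :
    TM2.stepAux (liftStmt g q) (v, x) (sumStacks s u) = liftCfg g v s (TM2.stepAux q x u) := by
  induction q generalizing x u with
  | push k f q ih => simp only [liftStmt, TM2.stepAux]; rw [update_sumStacks_inr, ← ih]; rfl
  | peek k f q ih => exact ih _ _
  | pop k f q ih => simp only [liftStmt, TM2.stepAux]; rw [update_sumStacks_inr, ← ih]; rfl
  | load f q ih => exact ih _ _
  | branch f q₁ q₂ ih₁ ih₂ =>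
    simp only [liftStmt, TM2.stepAux]
    cases f x
    · exact ih₂ _ _
    · exact ih₁ _ _
  | goto f => rfl
  | halt => rfl

theorem step_liftCfg {m : Λ → TM2.Stmt Γ Λ S}
    {m' : L → TM2.Stmt (sumAlphabet K A Γ) L (Option A × S)}
    (hm : ∀ l, m' (g l) = liftStmt g (m l)) (c : TM2.Cfg Γ Λ S) :
    TM2.step m' (liftCfg g v s c) = (TM2.step m c).map (liftCfg g v s) := by
  rcases c with ⟨_ | l, x, u⟩
  · rfl
  · simp only [liftCfg, Option.map_some, TM2.step, hm, stepAux_liftStmt]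

/-- The embedded machine runs in lockstep with the original one, halted configurations included, so
no time is lost. -/
theorem iterate_step_liftCfg {m : Λ → TM2.Stmt Γ Λ S}
    {m' : L → TM2.Stmt (sumAlphabet K A Γ) L (Option A × S)}
    (hm : ∀ l, m' (g l) = liftStmt g (m l)) (n : ℕ) (c : Option (TM2.Cfg Γ Λ S)) :
    (flip bind (TM2.step m'))^[n] (c.map (liftCfg g v s)) =
      ((flip bind (TM2.step m))^[n] c).map (liftCfg g v s) := by
  induction n generalizing c with
  | zero => rfl
  | succ n ih =>
    rw [Function.iterate_succ_apply, Function.iterate_succ_apply, ← ih]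
    congr 1
    cases c with
    | none => rfl
    | some c => exact step_liftCfg g v s hm c

end

/-- The labels of the machine that runs a command, copies a stack, and then runs another machine. -/
abbrev CompLab {K A : Type} (c : Cmd K A) (Λ : Type) : Type := c.Lab ⊕ Unit ⊕ Λ

/-- The program of the machine that runs `c`, moves the stack `out` to the input stack of the machine
`M`, which reverses the order of the symbols, and then runs `M`. -/
def compCode {K A : Type} [Inhabited A] (c : Cmd K A) (out : K) (M : FinTM2)
    (conv : A → M.Γ M.k₀) :
    CompLab c M.Λ → TM2.Stmt (sumAlphabet K A M.Γ) (CompLab c M.Λ) (Option A × M.σ)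
  | .inl l => c.code Sum.inl (.inr (.inl ())) l
  | .inr (.inl _) => .pop (.inl out) (fun v o => (o, v.2)) (.branch (fun v => v.1.isSome)
      (.push (.inr M.k₀) (fun v => conv (v.1.getD default)) (.goto fun _ => .inr (.inl ())))
      (.goto fun _ => .inr (.inr M.main)))
  | .inr (.inr l) => liftStmt (fun l => .inr (.inr l)) (M.m l)

/-- The machine that runs `c` with the input stack `inp`, moves the stack `out` to the input stack of
`M`, and then runs `M`. -/
noncomputable def compTM {K A : Type} [DecidableEq K] [Fintype K] [Fintype A] [Inhabited A]
    (c : Cmd K A) (inp out : K) (M : FinTM2) (conv : A → M.Γ M.k₀) : FinTM2 :=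
  letI := M.kFin
  letI := M.ΛFin
  letI := M.σFin
  letI := Cmd.Lab.fintype c
  { K := K ⊕ M.K
    k₀ := .inl inp
    k₁ := .inr M.k₁
    Γ := sumAlphabet K A M.Γ
    Λ := CompLab c M.Λ
    main := .inl c.entry
    σ := Option A × M.σ
    initialState := (none, M.initialState)
    Γk₀Fin := inferInstanceAs (Fintype A)
    m := compCode c out M conv }

/-- One step per symbol, and one that finds the stack empty. This last pop also resets the register
to `none`, its initial value. -/
theorem iterate_move {K A : Type} [DecidableEq K] [Inhabited A] (c : Cmd K A) (out : K) (M : FinTM2)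
    (conv : A → M.Γ M.k₀) (w : List A) (v : Option A) (s : K → List A) (hs : s out = w)
    (u : ∀ k, List (M.Γ k)) :
    (flip bind (TM2.step (compCode c out M conv)))^[w.length + 1]
        (some ⟨some (.inr (.inl ())), (v, M.initialState), sumStacks s u⟩) =
      some ⟨some (.inr (.inr M.main)), (none, M.initialState), sumStacks (Function.update s out [])
        (Function.update u M.k₀ ((w.map conv).reverse ++ u M.k₀))⟩ := by
  induction w generalizing v s u with
  | nil =>
    refine iterate_bind_succ (n := 0) ?_ rfl
    simp only [TM2.step, compCode, TM2.stepAux]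
    rw [update_sumStacks_inl]
    simp [sumStacks, hs]
  | cons a w ih =>
    have := ih (some a) (Function.update s out w) (by simp)
      (Function.update u M.k₀ (conv a :: u M.k₀))
    simp only [Function.update_idem, Function.update_self] at this
    rw [List.map_cons, List.reverse_cons, List.append_assoc]
    refine iterate_bind_succ ?_ this
    simp only [TM2.step, compCode, TM2.stepAux]
    rw [update_sumStacks_inl, update_sumStacks_inr]
    simp [sumStacks, hs]

theorem initList_eq (M : FinTM2) (w : List (M.Γ M.k₀)) : initList M w =
    ⟨some M.main, M.initialState, Function.update (fun _ => []) M.k₀ w⟩ := by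
  unfold initList
  congr 1
  funext k
  by_cases h : k = M.k₀
  · subst h; simp
  · simp [h]

theorem haltList_eq (M : FinTM2) (w : List (M.Γ M.k₁)) : haltList M w =
    ⟨none, M.initialState, Function.update (fun _ => []) M.k₁ w⟩ := by
  unfold haltList
  congr 1
  funext k
  by_cases h : k = M.k₁
  · subst h; simp
  · simp [h]

theorem sumStacks_nil {K K₂ A : Type} {Γ : K₂ → Type} :
    sumStacks (fun _ : K => ([] : List A)) (fun k => ([] : List (Γ k))) = fun _ => [] := by
  funext k
  rcases k with k | k <;> rfl

theorem initList_compTM {K A : Type} [DecidableEq K] [Fintype K] [Fintype A] [Inhabited A]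
    (c : Cmd K A) (inp out : K) (M : FinTM2) (conv : A → M.Γ M.k₀) (w : List A) :
    initList (compTM c inp out M conv) w = (⟨some (.inl c.entry), (none, M.initialState),
      sumStacks (Function.update (fun _ => []) inp w) fun _ => []⟩ : TM2.Cfg _ _ _) := by
  rw [← update_sumStacks_inl, sumStacks_nil]
  exact initList_eq _ _

/-- A proper halting configuration has its initial state and only the output on its stacks. This is
why the command must clean up all stacks but `out`, and the move must empty `out`. -/
theorem haltList_compTM {K A : Type} [DecidableEq K] [Fintype K] [Fintype A] [Inhabited A]
    (c : Cmd K A) (inp out : K) (M : FinTM2) (conv : A → M.Γ M.k₀) (w : List (M.Γ M.k₁)) :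
    haltList (compTM c inp out M conv) w = (⟨none, (none, M.initialState),
      sumStacks (fun _ => []) (Function.update (fun _ => []) M.k₁ w)⟩ : TM2.Cfg _ _ _) := by
  rw [← update_sumStacks_inr, sumStacks_nil]
  exact haltList_eq _ _

/-- If a command translates words for instances of one problem into words for equivalent instances of
another problem, then a machine for the latter yields a machine for the former. -/
theorem DisjASP.SolvableInTime.of_exec {α β K A Γ : Type} [DecidableEq K] [Fintype K] [Fintype A]
    [Inhabited A] {EncA : α → List A → Prop} {PA : α → Prop} {TA : α → List A → ℝ}
    {EncB : β → List Γ → Prop} {PB : β → Prop} {TB : β → List Γ → ℝ}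
    (hB : SolvableInTime EncB PB TB) (c : Cmd K A) (inp out : K) (conv : A → Γ)
    (h : ∀ a w, EncA a w → ∃ b u t,
      c.Exec (Function.update (fun _ => []) inp w) (Function.update (fun _ => []) out u) t ∧
      EncB b (u.map conv).reverse ∧ (PA a ↔ PB b) ∧
      (t + (u.length + 1) : ℕ) + TB b (u.map conv).reverse ≤ TA a w) :
    SolvableInTime EncA PA TA := by
  obtain ⟨M, hM⟩ := hB
  refine ⟨⟨compTM c inp out M.tm (fun a => M.inputAlphabet.symm (conv a)), Equiv.refl A,
    M.outputAlphabet⟩, fun a w haw => ?_⟩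
  obtain ⟨b, u, t, hc, hb, hab, hT⟩ := h a w haw
  obtain ⟨r, t', hr, ht', ⟨⟨steps, hsteps⟩, hle⟩⟩ := hM b _ hb
  refine ⟨r, t + (u.length + 1) + t', hr.trans hab.symm, ?_, ⟨⟨t + (u.length + 1) + steps, ?_⟩, ?_⟩⟩
  · push_cast at hT ⊢
    linarith
  -- Three runs are glued together: the command, the move of `out` to the input stack, and the
  -- embedded run of the given machine.
  · obtain ⟨v', hv'⟩ := hc.iterate_step
      (m := compCode c out M.tm (fun a => M.inputAlphabet.symm (conv a))) Sum.inl (.inr (.inl ()))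
      (fun l => rfl) none M.tm.initialState (fun _ => [])
    have h₂ := iterate_move c out M.tm (fun a => M.inputAlphabet.symm (conv a)) u v'
      (Function.update (fun _ => []) out u) (by simp) (fun _ => [])
    have h₃ := iterate_step_liftCfg (K := K) (A := A) (L := CompLab c M.tm.Λ)
      (fun l => .inr (.inr l)) none (fun _ => [])
      (m := M.tm.m) (m' := compCode c out M.tm (fun a => M.inputAlphabet.symm (conv a)))
      (fun l => rfl) steps
      (some (initList M.tm (((u.map conv).reverse).map M.inputAlphabet.symm)))
    replace h₃ := h₃.trans (congrArg (Option.map _) hsteps)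
    rw [initList_eq, Option.map_some, Option.map_some, haltList_eq] at h₃
    simp only [liftCfg, Option.map_some] at h₃
    rw [Function.update_idem, Function.update_eq_self, List.append_nil] at h₂
    rw [List.map_reverse, List.map_map] at h₃
    have := iterate_bind_trans (iterate_bind_trans hv' h₂) h₃
    refine Eq.trans (congrArg _ (congrArg some ?_)) (this.trans (congrArg some ?_))
    · exact (congrArg _ (List.map_id w)).trans (initList_compTM ..)
    · exact (haltList_compTM ..).symm
  · exact Nat.add_le_add_left hle _

/-! ### Binary codes -/

/-- The `L` least significant bits of `j`, the least significant one first. -/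
def bitsOf : ℕ → ℕ → List Bool
  | 0, _ => []
  | L + 1, j => decide (j % 2 = 1) :: bitsOf L (j / 2)

@[simp]
theorem length_bitsOf (L j : ℕ) : (bitsOf L j).length = L := by
  induction L generalizing j with
  | zero => rfl
  | succ L ih => simp [bitsOf, ih]

theorem bitsOf_zero (L : ℕ) : bitsOf L 0 = List.replicate L false := by
  induction L with
  | zero => rfl
  | succ L ih => simp [bitsOf, ih, List.replicate_succ]

theorem bitsOf_two_pow_sub_one (L : ℕ) : bitsOf L (2 ^ L - 1) = List.replicate L true := by
  induction L with
  | zero => rfl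
  | succ L ih =>
    have h : 0 < 2 ^ L := by positivity
    have h₁ : (2 ^ (L + 1) - 1) % 2 = 1 := by rw [pow_succ]; omega
    have h₂ : (2 ^ (L + 1) - 1) / 2 = 2 ^ L - 1 := by rw [pow_succ]; omega
    simp [bitsOf, h₁, h₂, ih, List.replicate_succ]

/-- The value of a counter of `L` ones after an increment that adds a bit. -/
theorem bitsOf_succ_two_pow (L : ℕ) :
    bitsOf (L + 1) (2 ^ L) = List.replicate L false ++ [true] := by
  induction L with
  | zero => rfl
  | succ L ih =>
    have h₁ : 2 ^ (L + 1) % 2 = 0 := by rw [pow_succ]; omega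
    have h₂ : 2 ^ (L + 1) / 2 = 2 ^ L := by rw [pow_succ]; omega
    rw [bitsOf, h₁, h₂, ih]
    simp [List.replicate_succ]

/-- The increment of a binary number. -/
theorem bitsOf_add_one {L j : ℕ} (h : j + 1 < 2 ^ L) : ∃ k r, k < L ∧
    bitsOf L j = List.replicate k true ++ false :: r ∧
    bitsOf L (j + 1) = List.replicate k false ++ true :: r := by
  induction L generalizing j with
  | zero => simp at h
  | succ L ih =>
    rw [pow_succ] at h
    rcases Nat.mod_two_eq_zero_or_one j with hj | hj
    · refine ⟨0, bitsOf L (j / 2), by omega, by simp [bitsOf, hj], ?_⟩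
      have h₁ : (j + 1) % 2 = 1 := by omega
      have h₂ : (j + 1) / 2 = j / 2 := by omega
      simp [bitsOf, h₁, h₂]
    · obtain ⟨k, r, hk, e₁, e₂⟩ := ih (j := j / 2) (by omega)
      have h₁ : (j + 1) % 2 = 0 := by omega
      have h₂ : (j + 1) / 2 = j / 2 + 1 := by omega
      exact ⟨k + 1, r, by omega, by simp [bitsOf, hj, e₁, List.replicate_succ],
        by simp [bitsOf, h₁, h₂, e₂, List.replicate_succ]⟩

theorem bitsOf_injOn {L i j : ℕ} (hi : i < 2 ^ L) (hj : j < 2 ^ L)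
    (h : bitsOf L i = bitsOf L j) : i = j := by
  induction L generalizing i j with
  | zero => simp at hi hj; omega
  | succ L ih =>
    rw [pow_succ] at hi hj
    simp only [bitsOf, List.cons.injEq, decide_eq_decide] at h
    have := ih (i := i / 2) (j := j / 2) (by omega) (by omega) h.2
    omega

/-- Any choice of bits made by a model thus points at a clause or at an unused code. -/
theorem exists_bitsOf (bs : List Bool) : ∃ j < 2 ^ bs.length, bitsOf bs.length j = bs := by
  induction bs with
  | nil => exact ⟨0, by simp, rfl⟩
  | cons b bs ih =>
    obtain ⟨j, hj, e⟩ := ih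
    refine ⟨2 * j + b.toNat, ?_, ?_⟩
    · rw [List.length_cons, pow_succ]
      cases b <;> (simp; omega)
    · have h₂ : (2 * j + b.toNat) / 2 = j := by cases b <;> simp <;> omega
      rw [List.length_cons, bitsOf, h₂, e]
      cases b <;> simp

/-- The atoms that represent a list of bits: `o` or `o + 1` for the first bit, `o + 2` or `o + 3` for
the second one, and so on. -/
def codeAtoms : ℕ → List Bool → List ℕ
  | _, [] => []
  | o, b :: bs => (o + b.toNat) :: codeAtoms (o + 2) bs

/-! ### The rules of the program of a formula -/

/-- The rules of the program of a formula. The atom `0` is the saturation atom, the atoms `2 * i + 1`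
and `2 * i + 2` represent the two values of the bit `i` of the number of a clause, and for codes of
length `L` the atoms `2 * (L + v) + 1` and `2 * (L + v) + 2` represent the two values of the
variable `v`. -/
inductive Key
  | constr
  | guess (i : ℕ)
  | satL (i : ℕ)
  | satR (i : ℕ)
  | lit (b : List Bool) (v : ℕ) (s : Bool)
  | unused (b : List Bool)

namespace Key

/-- The head of a rule. -/
def head : Key → List ℕ
  | constr => []
  | guess i => [2 * i + 1, 2 * i + 2]
  | satL i => [2 * i + 1]
  | satR i => [2 * i + 2]
  | lit _ _ _ => [0]
  | unused _ => [0]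

/-- The positive body of a rule. -/
def pos : Key → List ℕ
  | constr => []
  | guess _ => []
  | satL _ => [0]
  | satR _ => [0]
  | lit b v true => codeAtoms 1 b ++ [2 * (b.length + v) + 1]
  | lit b _ false => codeAtoms 1 b
  | unused b => codeAtoms 1 b

/-- The negative body of a rule. -/
def neg : Key → List ℕ
  | constr => [0]
  | lit b v false => [2 * (b.length + v) + 1]
  | _ => []

end Key

/-- The keys of the rules for a list of clauses that are numbered from `j` on. -/
def clauseKeys (L : ℕ) : ℕ → List (List Literal) → List Key
  | _, [] => []
  | j, c :: cs => c.map (fun l => Key.lit (bitsOf L j) l.1 l.2) ++ clauseKeys L (j + 1) cs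

/-- The keys of all rules for a list of clauses. -/
def allKeys (L B : ℕ) (cs : List (List Literal)) : List Key :=
  .constr :: ((List.range' 0 L).flatMap (fun i => [.guess i, .satL i, .satR i]) ++
    (List.range' L B).map .guess ++ clauseKeys L 0 cs ++
    (List.range' cs.length (2 ^ L - cs.length)).map (fun j => .unused (bitsOf L j)))

/-- A word of ticks. -/
abbrev ticks (n : ℕ) : List CNFSymbol := List.replicate n .tick

theorem ticks_append_cons (n : ℕ) (l : List CNFSymbol) :
    ticks n ++ .tick :: l = .tick :: (ticks n ++ l) := by
  rw [List.append_cons, ← List.replicate_succ', List.replicate_succ, List.cons_append]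

/-- A list of atoms as a word; the end mark of an atom is `CNFSymbol.pos`. -/
def atomTicks (l : List ℕ) : List CNFSymbol := l.flatMap fun a => ticks a ++ [.pos]

/-- The word of a rule. -/
def Key.word (k : Key) : List CNFSymbol :=
  atomTicks k.head ++ [.bar] ++ atomTicks k.pos ++ [.bar] ++ atomTicks k.neg ++ [.bar]

/-! ### The translation as a command -/

/-- The stacks of the translation. -/
inductive Stk
  | inp | out | aux | cnt | cnt2 | idx | tmp | var | flag
  deriving DecidableEq

instance : Fintype Stk where
  elems := {.inp, .out, .aux, .cnt, .cnt2, .idx, .tmp, .var, .flag}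
  complete k := by cases k <;> decide

/-- The contents of the stacks of the translation; the list `out` is reversed on its stack. -/
structure St where
  inp : List CNFSymbol
  out : List CNFSymbol
  aux : List CNFSymbol
  cnt : List CNFSymbol
  cnt2 : List CNFSymbol
  idx : List CNFSymbol
  tmp : List CNFSymbol
  var : List CNFSymbol
  flag : List CNFSymbol

namespace St

/-- The contents of a stack. -/
def get (S : St) : Stk → List CNFSymbol
  | .inp => S.inp
  | .out => S.out.reverse
  | .aux => S.aux
  | .cnt => S.cnt
  | .cnt2 => S.cnt2
  | .idx => S.idx
  | .tmp => S.tmp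
  | .var => S.var
  | .flag => S.flag

/-- Replace the contents of a stack. -/
def set (S : St) (k : Stk) (l : List CNFSymbol) : St :=
  match k with
  | .inp => { S with inp := l }
  | .out => { S with out := l.reverse }
  | .aux => { S with aux := l }
  | .cnt => { S with cnt := l }
  | .cnt2 => { S with cnt2 := l }
  | .idx => { S with idx := l }
  | .tmp => { S with tmp := l }
  | .var => { S with var := l }
  | .flag => { S with flag := l }

theorem get_set (S : St) (k : Stk) (l : List CNFSymbol) :
    (S.set k l).get = Function.update S.get k l := by
  funext k'
  cases k <;> cases k' <;> simp [set, get]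

end St

/-- The command `c` turns the stacks `S` into the stacks `S'` in at most `T` steps. -/
def Runs (c : Cmd Stk CNFSymbol) (S S' : St) (T : ℕ) : Prop :=
  ∃ t ≤ T, c.Exec S.get S'.get t

/-- Sequential composition. -/
infixr:60 " ;; " => Cmd.seq

namespace Runs

variable {c d : Cmd Stk CNFSymbol} {S S' S'' : St} {T T' : ℕ}

theorem mono (h : Runs c S S' T) (hT : T ≤ T') : Runs c S S' T' :=
  let ⟨t, ht, h⟩ := h
  ⟨t, ht.trans hT, h⟩

theorem congr (h : Runs c S S' T) (hS : S' = S'') (hT : T ≤ T') : Runs c S S'' T' :=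
  hS ▸ h.mono hT

theorem seq (h : Runs c S S' T) (h' : Runs d S' S'' T') : Runs (c ;; d) S S'' (T + T') :=
  let ⟨_, ht, h⟩ := h
  let ⟨_, ht', h'⟩ := h'
  ⟨_, Nat.add_le_add ht ht', h.seq h'⟩

theorem skip (S : St) : Runs .skip S S 1 := ⟨1, le_rfl, .skip _⟩

theorem push (S : St) (k : Stk) (a : CNFSymbol) :
    Runs (.push k a) S (S.set k (a :: S.get k)) 1 :=
  ⟨1, le_rfl, S.get_set k _ ▸ .push k a _⟩

theorem push_out (S : St) (a : CNFSymbol) :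
    Runs (.push .out a) S { S with out := S.out ++ [a] } 1 :=
  (push S .out a).congr (by simp [St.set, St.get]) le_rfl

theorem case {k : Stk} {f : Option CNFSymbol → Cmd Stk CNFSymbol}
    (h : Runs (f (S.get k).head?) (S.set k (S.get k).tail) S' T) :
    Runs (.case k f) S S' (T + 1) :=
  let ⟨_, ht, h⟩ := h
  ⟨_, Nat.add_le_add_right ht 1, .case (S.get_set k _ ▸ h)⟩

theorem loop_nil {k : Stk} {f : CNFSymbol → Cmd Stk CNFSymbol} (h : S.get k = []) :
    Runs (.loop k f) S S 1 :=
  ⟨1, le_rfl, .loop_nil h⟩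

theorem loop_cons {k : Stk} {f : CNFSymbol → Cmd Stk CNFSymbol} {a : CNFSymbol}
    {l : List CNFSymbol} (hk : S.get k = a :: l) (h : Runs (f a) (S.set k l) S' T)
    (h' : Runs (.loop k f) S' S'' T') : Runs (.loop k f) S S'' (T + T' + 1) :=
  let ⟨_, ht, h⟩ := h
  let ⟨_, ht', h'⟩ := h'
  ⟨_, by omega, .loop_cons hk (S.get_set k _ ▸ h) h'⟩

end Runs

/-! ### Commands that write numbers, codes and single rules -/

/-- Write a word to the output. -/
def emit : List CNFSymbol → Cmd Stk CNFSymbol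
  | [] => .skip
  | a :: w => .push .out a ;; emit w

theorem runs_emit (w : List CNFSymbol) (S : St) :
    Runs (emit w) S { S with out := S.out ++ w } (w.length + 1) := by
  induction w generalizing S with
  | nil => exact Runs.congr (Runs.skip S) (by simp) (by simp)
  | cons a w ih => exact Runs.congr ((Runs.push_out S a).seq (ih _)) (by simp) (by simp; omega)

/-- Move the ticks of `idx` to the output. -/
def flushIdx : Cmd Stk CNFSymbol := .loop .idx fun _ => .push .out .tick

theorem runs_flushIdx {S : St} {n : ℕ} (h : S.idx = ticks n) :
    Runs flushIdx S { S with idx := [], out := S.out ++ ticks n } (2 * n + 1) := by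
  induction n generalizing S with
  | zero => exact Runs.congr (Runs.loop_nil h) (by rcases S; simp_all) le_rfl
  | succ n ih =>
    exact Runs.congr (Runs.loop_cons h (Runs.push_out _ _) (ih rfl))
      (by simp [St.set, List.replicate_succ]) (by omega)

/-- Move the ticks of `var` to the output. -/
def flushVar : Cmd Stk CNFSymbol := .loop .var fun _ => .push .out .tick

theorem runs_flushVar {S : St} {n : ℕ} (h : S.var = ticks n) :
    Runs flushVar S { S with var := [], out := S.out ++ ticks n } (2 * n + 1) := by
  induction n generalizing S with
  | zero => exact Runs.congr (Runs.loop_nil h) (by rcases S; simp_all) le_rfl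
  | succ n ih =>
    exact Runs.congr (Runs.loop_cons h (Runs.push_out _ _) (ih rfl))
      (by simp [St.set, List.replicate_succ]) (by omega)

/-- Append the ticks of `idx` to the output. -/
def copyIdx : Cmd Stk CNFSymbol :=
  .loop .idx (fun _ => .push .tmp .tick ;; .push .out .tick) ;;
  .loop .tmp fun _ => .push .idx .tick

/-- Reading a stack destroys it, so the ticks pass through `tmp` and back: three steps per tick on
the way out and two on the way back. -/
theorem runs_copyIdx {S : St} {n : ℕ} (h : S.idx = ticks n) (ht : S.tmp = []) :
    Runs copyIdx S { S with out := S.out ++ ticks n } (5 * n + 2) := by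
  have h₁ : ∀ (n : ℕ) (S : St), S.idx = ticks n →
      Runs (.loop .idx (fun _ => .push .tmp .tick ;; .push .out .tick)) S
        { S with idx := [], tmp := ticks n ++ S.tmp, out := S.out ++ ticks n } (3 * n + 1) := by
    intro n
    induction n with
    | zero => exact fun S h => Runs.congr (Runs.loop_nil h) (by rcases S; simp_all) le_rfl
    | succ n ih =>
      intro S h
      refine Runs.congr (Runs.loop_cons h ((Runs.push _ _ _).seq (Runs.push_out _ _)) (ih _ rfl))
        ?_ (by omega)
      simp [St.set, St.get, List.replicate_succ, ticks_append_cons]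
  have h₂ : ∀ (n : ℕ) (S : St), S.tmp = ticks n →
      Runs (.loop .tmp (fun _ => .push .idx .tick)) S
        { S with tmp := [], idx := ticks n ++ S.idx } (2 * n + 1) := by
    intro n
    induction n with
    | zero => exact fun S h => Runs.congr (Runs.loop_nil h) (by rcases S; simp_all) le_rfl
    | succ n ih =>
      intro S h
      refine Runs.congr (Runs.loop_cons h (Runs.push _ _ _) (ih _ rfl)) ?_ (by omega)
      simp [St.set, St.get, List.replicate_succ, ticks_append_cons]
  refine ((h₁ n S h).seq (h₂ n _ (by simp [ht]))).congr ?_ (by omega)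
  rcases S
  simp_all

/-- The symbol of a bit. -/
def bitSymbol (b : Bool) : CNFSymbol := if b then .pos else .neg

/-- Move the stack `cnt2` to the stack `cnt`. -/
def restoreCnt : Cmd Stk CNFSymbol := .loop .cnt2 fun b => .push .cnt b

theorem runs_restoreCnt (S : St) :
    Runs restoreCnt S { S with cnt2 := [], cnt := S.cnt2.reverse ++ S.cnt }
      (2 * S.cnt2.length + 1) := by
  rcases S with ⟨i, o, a, c, c2, x, t, v, f⟩
  induction c2 generalizing c with
  | nil => exact Runs.congr (Runs.loop_nil rfl) (by simp) (by simp)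
  | cons b c2 ih =>
    exact Runs.congr (Runs.loop_cons rfl (Runs.push _ _ _) (ih _)) (by simp [St.get, St.set]) (by simp; omega)

/-- Append the atoms of the bits of `cnt` to the output, and add two ticks to `idx` for each bit. -/
def emitCode : Cmd Stk CNFSymbol :=
  .loop .cnt (fun b => .push .cnt2 b ;; copyIdx ;;
    emit (if b = .pos then [.tick, .pos] else [.pos]) ;;
    .push .idx .tick ;; .push .idx .tick) ;;
  restoreCnt

/-- `idx` holds the smaller atom of the current bit, and a bit of value one gets one more tick. `M`
bounds `idx` throughout, so that all rounds have the same time bound. -/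
theorem runs_emitCode {S : St} {n M : ℕ} {bs : List Bool} (hc : S.cnt = bs.map bitSymbol)
    (hc2 : S.cnt2 = []) (h : S.idx = ticks n) (ht : S.tmp = []) (hM : n + 2 * bs.length ≤ M) :
    Runs emitCode S { S with
      idx := ticks (n + 2 * bs.length), out := S.out ++ atomTicks (codeAtoms n bs) }
      (bs.length * (5 * M + 13) + 2) := by
  have h₁ : ∀ (bs : List Bool) (n : ℕ) (S : St), S.cnt = bs.map bitSymbol → S.idx = ticks n →
      S.tmp = [] → n + 2 * bs.length ≤ M →
      Runs (.loop .cnt (fun b => .push .cnt2 b ;; copyIdx ;;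
          emit (if b = .pos then [.tick, .pos] else [.pos]) ;;
          .push .idx .tick ;; .push .idx .tick)) S
        { S with
          cnt := []
          cnt2 := (bs.map bitSymbol).reverse ++ S.cnt2
          idx := ticks (n + 2 * bs.length)
          out := S.out ++ atomTicks (codeAtoms n bs) } (bs.length * (5 * M + 11) + 1) := by
    intro bs
    induction bs with
    | nil =>
      exact fun n S hc h _ _ => Runs.congr (Runs.loop_nil hc)
        (by rcases S; simp_all [codeAtoms, atomTicks]) (by simp)
    | cons b bs ih =>
      intro n S hc h ht hM
      rw [List.length_cons] at hM
      refine Runs.congr (Runs.loop_cons hc ((Runs.push _ _ _).seq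
        ((runs_copyIdx (n := n) (by exact h) (by exact ht)).seq
        ((runs_emit _ _).seq ((Runs.push _ _ _).seq (Runs.push _ _ _)))))
        (ih (n + 2) _ (by rfl) (by simp [St.set, St.get, h, List.replicate_succ]) (by exact ht)
          (by omega))) ?_ ?_
      · have : n + 2 + 2 * bs.length = n + 2 * (bs.length + 1) := by omega
        cases b <;>
          simp [St.set, St.get, bitSymbol, codeAtoms, atomTicks, this, List.replicate_succ']
      · have : ∀ b : CNFSymbol, ((if b = CNFSymbol.pos then [CNFSymbol.tick, CNFSymbol.pos]
            else [CNFSymbol.pos]).length) ≤ 2 := by intro b; split_ifs <;> simp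
        have := this (bitSymbol b)
        rw [List.length_cons, Nat.add_mul]
        omega
  refine Runs.congr ((h₁ bs n S hc h ht hM).seq (runs_restoreCnt _)) ?_ ?_
  · rcases S
    simp_all
  · simp only [hc2, List.append_nil, List.length_reverse, List.length_map]
    rw [show 5 * M + 13 = (5 * M + 11) + 2 from rfl, Nat.mul_add _ (5 * M + 11)]
    omega

theorem ticks_add (m n : ℕ) : ticks (m + n) = ticks m ++ ticks n :=
  List.replicate_add ..

/-- Delete the ticks of `idx`. -/
def clearIdx : Cmd Stk CNFSymbol := .loop .idx fun _ => .skip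

theorem runs_clearIdx {S : St} {n : ℕ} (h : S.idx = ticks n) :
    Runs clearIdx S { S with idx := [] } (2 * n + 1) := by
  induction n generalizing S with
  | zero => exact Runs.congr (Runs.loop_nil h) (by rcases S; simp_all) le_rfl
  | succ n ih =>
    exact Runs.congr (Runs.loop_cons h (Runs.skip _) (ih (by rfl))) (by simp [St.set]) (by omega)

/-- Delete the bits of `cnt`. -/
def clearCnt : Cmd Stk CNFSymbol := .loop .cnt fun _ => .skip

theorem runs_clearCnt (S : St) :
    Runs clearCnt S { S with cnt := [] } (2 * S.cnt.length + 1) := by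
  rcases S with ⟨i, o, a, c, c2, x, t, v, f⟩
  induction c with
  | nil => exact Runs.congr (Runs.loop_nil rfl) (by simp) (by simp)
  | cons b c2 ih =>
    exact Runs.congr (Runs.loop_cons rfl (Runs.skip _) ih) (by simp) (by simp; omega)

/-- Write the rule for a literal with the code in `cnt` and the variable in `var`. -/
def litRule (s : Bool) : Cmd Stk CNFSymbol :=
  .push .idx .tick ;; emit [.pos, .bar] ;; emitCode ;; emit (if s then [] else [.bar]) ;;
  flushIdx ;; flushVar ;; emit (if s then [.pos, .bar, .bar] else [.pos, .bar])

/-- After the code, `idx` has `2 * bs.length + 1` ticks and `var` has `2 * v`; together they spell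
the atom of the variable. The sign decides whether the bar that opens the negative body comes before
or after it. -/
theorem runs_litRule {M v : ℕ} {bs : List Bool} (i o a : List CNFSymbol) (s : Bool)
    (hM : 2 * (bs.length + v) + 1 ≤ M) :
    Runs (litRule s) ⟨i, o, a, bs.map bitSymbol, [], [], [], ticks (2 * v), []⟩
      ⟨i, o ++ (Key.lit bs v s).word, a, bs.map bitSymbol, [], [], [], [], []⟩
      (20 * (M + 1) ^ 2) := by
  refine Runs.congr ((Runs.push _ _ _).seq ((runs_emit _ _).seq
    ((runs_emitCode (n := 1) (M := M) (by rfl) (by rfl) (by rfl) (by rfl) (by omega)).seq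
    ((runs_emit _ _).seq ((runs_flushIdx (by rfl)).seq ((runs_flushVar (by rfl)).seq
    (runs_emit _ _))))))) ?_ ?_
  · have h : ticks (2 * (bs.length + v) + 1) = ticks (1 + 2 * bs.length) ++ ticks (2 * v) := by
      rw [← ticks_add]; congr 1; ring
    cases s <;> simp [St.set, St.get, Key.word, Key.head, Key.pos, Key.neg, h, atomTicks]
  · have h₁ : bs.length * (5 * M + 13) ≤ M * (5 * M + 13) := Nat.mul_le_mul_right _ (by omega)
    have h₂ : (if s then ([] : List CNFSymbol) else [.bar]).length ≤ 1 := by cases s <;> simp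
    have h₃ : (if s then ([.pos, .bar, .bar] : List CNFSymbol) else [.pos, .bar]).length ≤ 3 := by
      cases s <;> simp
    simp only [List.length_cons, List.length_nil]
    nlinarith

/-- Write the rule for an unused code in `cnt`. -/
def unusedRule : Cmd Stk CNFSymbol :=
  .push .idx .tick ;; emit [.pos, .bar] ;; emitCode ;; clearIdx ;; emit [.bar, .bar]

theorem runs_unusedRule {M : ℕ} {bs : List Bool} (i o a : List CNFSymbol)
    (hM : 2 * bs.length + 1 ≤ M) :
    Runs unusedRule ⟨i, o, a, bs.map bitSymbol, [], [], [], [], []⟩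
      ⟨i, o ++ (Key.unused bs).word, a, bs.map bitSymbol, [], [], [], [], []⟩
      (20 * (M + 1) ^ 2) := by
  refine Runs.congr ((Runs.push _ _ _).seq ((runs_emit _ _).seq
    ((runs_emitCode (n := 1) (M := M) (by rfl) (by rfl) (by rfl) (by rfl) (by omega)).seq
    ((runs_clearIdx (by rfl)).seq (runs_emit _ _))))) ?_ ?_
  · simp [St.set, St.get, Key.word, Key.head, Key.pos, Key.neg, atomTicks]
  · have h₁ : bs.length * (5 * M + 13) ≤ M * (5 * M + 13) := Nat.mul_le_mul_right _ (by omega)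
    simp only [List.length_cons, List.length_nil]
    nlinarith

/-! ### The binary counter -/

/-- Increment the binary number in `cnt`, and then run `ok`, or run `ovf` if there is an overflow. -/
def inc (ovf ok : Cmd Stk CNFSymbol) : Cmd Stk CNFSymbol :=
  .push .flag .tick ;;
  .loop .flag (fun _ => .case .cnt fun
    | none => ovf
    | some .neg => .push .cnt .pos ;; ok
    | some _ => .push .cnt2 .neg ;; .push .flag .tick) ;;
  restoreCnt

/-- A tick on `flag` is a pending carry. The carry turns the leading ones into zeros on `cnt2`; the
hypothesis `h` describes only its end, so that increments with and without overflow share the proof.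
-/
theorem runs_inc_loop {ovf ok : Cmd Stk CNFSymbol} {i o a a' c c' x t v : List CNFSymbol} {T : ℕ}
    (h : ∀ c2, Runs (.case .cnt fun
        | none => ovf
        | some .neg => .push .cnt .pos ;; ok
        | some _ => .push .cnt2 .neg ;; .push .flag .tick)
      ⟨i, o, a, c, c2, x, t, v, []⟩ ⟨i, o, a', c', c2, x, t, v, []⟩ T) (k : ℕ) :
    Runs (inc ovf ok) ⟨i, o, a, List.replicate k .pos ++ c, [], x, t, v, []⟩
      ⟨i, o, a', List.replicate k .neg ++ c', [], x, t, v, []⟩ (6 * k + T + 5) := by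
  have h₁ : ∀ (k : ℕ) (c2 : List CNFSymbol),
      Runs (.loop .flag (fun _ => .case .cnt fun
        | none => ovf
        | some .neg => .push .cnt .pos ;; ok
        | some _ => .push .cnt2 .neg ;; .push .flag .tick))
      ⟨i, o, a, List.replicate k .pos ++ c, c2, x, t, v, [.tick]⟩
      ⟨i, o, a', c', List.replicate k .neg ++ c2, x, t, v, []⟩ (4 * k + T + 2) := by
    intro k
    induction k with
    | zero => exact fun c2 => Runs.congr (Runs.loop_cons rfl (h c2) (Runs.loop_nil rfl)) rfl (by omega)
    | succ k ih =>
      intro c2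
      refine Runs.congr (Runs.loop_cons rfl (Runs.case ((Runs.push _ _ _).seq (Runs.push _ _ _)))
        (ih (.neg :: c2))) ?_ (by omega)
      rw [List.append_cons, ← List.replicate_succ']
  refine Runs.congr ((Runs.push _ _ _).seq ((h₁ k []).seq (runs_restoreCnt _))) ?_ ?_
  · simp
  · simp only [List.append_nil, List.length_replicate]
    omega

theorem runs_inc {ovf ok : Cmd Stk CNFSymbol} {i o a p x t v : List CNFSymbol}
    (hok : ∀ S : St, Runs ok S { S with aux := p ++ S.aux } 1) {L j : ℕ} (hj : j + 1 < 2 ^ L) :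
    Runs (inc ovf ok) ⟨i, o, a, (bitsOf L j).map bitSymbol, [], x, t, v, []⟩
      ⟨i, o, p ++ a, (bitsOf L (j + 1)).map bitSymbol, [], x, t, v, []⟩ (6 * L + 8) := by
  obtain ⟨k, r, hk, e₁, e₂⟩ := bitsOf_add_one hj
  rw [e₁, e₂, List.map_append, List.map_append, List.map_replicate, List.map_replicate]
  refine Runs.mono (runs_inc_loop (T := 3) (fun c2 => Runs.case (T := 2) ?_) k) (by omega)
  exact (Runs.push _ _ _).seq (hok _)

/-- With `q = []` the counter wraps around to zero; with `q = [.pos]` it grows by one bit. -/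
theorem runs_inc_overflow {ovf ok : Cmd Stk CNFSymbol} {i o a q x t v : List CNFSymbol}
    (hovf : ∀ S : St, Runs ovf S { S with cnt := q ++ S.cnt } 1) {L : ℕ} :
    Runs (inc ovf ok) ⟨i, o, a, (bitsOf L (2 ^ L - 1)).map bitSymbol, [], x, t, v, []⟩
      ⟨i, o, a, List.replicate L .neg ++ q, [], x, t, v, []⟩ (6 * L + 8) := by
  rw [bitsOf_two_pow_sub_one, List.map_replicate, ← List.append_nil (List.replicate L _)]
  exact (runs_inc_loop (c := []) (fun c2 => Runs.case
    (Runs.congr (hovf _) (by simp [St.set, St.get]) le_rfl)) L).mono (by omega)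

/-! ### Reading the formula and writing its rules -/

/-- Process a symbol of the formula. -/
def readSymbol : CNFSymbol → Cmd Stk CNFSymbol
  | .tick => .push .var .tick ;; .push .var .tick
  | .pos => litRule true
  | .neg => litRule false
  | .bar => inc .skip .skip

section

variable {M L : ℕ} {S : St} {T : ℕ} {i o a : List CNFSymbol}

/-- Stated in continuation style: a run of the loop on the rest of the input is extended backwards
by one literal. -/
theorem runs_read_literal {bs : List Bool} {v : ℕ} {s : Bool}
    (h : Runs (.loop .inp readSymbol)
      ⟨i, o ++ (Key.lit bs v s).word, a, bs.map bitSymbol, [], [], [], [], []⟩ S T)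
    (hM : 2 * (bs.length + v) + 1 ≤ M) :
    Runs (.loop .inp readSymbol)
      ⟨ticks v ++ [if s then .pos else .neg] ++ i, o, a, bs.map bitSymbol, [], [], [], [], []⟩ S
      (T + (v + 1) * (20 * (M + 1) ^ 2 + 1)) := by
  -- `x` ticks are still to be read; the other `n` are already on `var`, doubled.
  have key : ∀ x n : ℕ, n + x = v → Runs (.loop .inp readSymbol)
      ⟨ticks x ++ [if s then .pos else .neg] ++ i, o, a, bs.map bitSymbol, [], [], [],
        ticks (2 * n), []⟩ S (T + (x + 1) * (20 * (M + 1) ^ 2 + 1)) := by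
    intro x
    induction x with
    | zero =>
      rintro n rfl
      refine Runs.congr (Runs.loop_cons (by rfl) ?_ h) rfl
        (T := 20 * (M + 1) ^ 2 + T + 1) (by omega)
      cases s <;> exact runs_litRule i o a _ hM
    | succ x ih =>
      intro n hn
      refine Runs.congr (Runs.loop_cons (a := .tick) rfl ((Runs.push _ _ _).seq (Runs.push _ _ _))
        (ih (n + 1) (by omega))) rfl ?_
      nlinarith [Nat.zero_le (20 * (M + 1) ^ 2)]
  exact key v 0 (by omega)

theorem runs_read_literals {bs : List Bool} {l : List Literal}
    (h : Runs (.loop .inp readSymbol)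
      ⟨i, o ++ (l.map fun x => Key.lit bs x.1 x.2).flatMap Key.word, a, bs.map bitSymbol,
        [], [], [], [], []⟩ S T)
    (hM : 2 * (bs.length + (literalsWord l).length) + 1 ≤ M) :
    Runs (.loop .inp readSymbol)
      ⟨literalsWord l ++ i, o, a, bs.map bitSymbol, [], [], [], [], []⟩ S
      (T + (literalsWord l).length * (20 * (M + 1) ^ 2 + 1)) := by
  induction l generalizing o with
  | nil => exact Runs.congr (S := ⟨_, _, _, _, _, _, _, _, _⟩) (by simpa [literalsWord] using h) rfl (by simp [literalsWord])
  | cons x l ih =>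
    have e : literalsWord (x :: l) = ticks x.1 ++ [if x.2 then .pos else .neg] ++ literalsWord l := by
      simp [literalsWord]
    rw [e] at hM ⊢
    simp only [List.length_append, List.length_replicate, List.length_singleton] at hM
    rw [List.append_assoc]
    refine Runs.congr (runs_read_literal (M := M) (ih (by simpa using h) (by omega)) (by omega))
      rfl ?_
    simp only [List.length_append, List.length_replicate, List.length_singleton]
    exact le_of_eq (by ring)

/-- A list of clauses as a word. -/
def clausesWord (cs : List (List Literal)) : List CNFSymbol :=
  cs.flatMap fun c => literalsWord c ++ [.bar]

/-- Each bar increments the clause number. The strict bound in `hj` rules out an overflow even after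
the last clause. -/
theorem runs_read_clauses (cs : List (List Literal)) (j : ℕ)
    (hj : j + cs.length < 2 ^ L) (hM : 2 * (L + (clausesWord cs).length) + 8 ≤ M) :
    Runs (.loop .inp readSymbol)
      ⟨clausesWord cs, o, a, (bitsOf L j).map bitSymbol, [], [], [], [], []⟩
      ⟨[], o ++ (clauseKeys L j cs).flatMap Key.word, a,
        (bitsOf L (j + cs.length)).map bitSymbol, [], [], [], [], []⟩
      ((clausesWord cs).length * (20 * (M + 1) ^ 2 + 1) + 1) := by
  induction cs generalizing o j with
  | nil => exact Runs.congr (Runs.loop_nil rfl) (by simp [clauseKeys, clausesWord]) (by simp)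
  | cons c cs ih =>
    have e : clausesWord (c :: cs) = literalsWord c ++ (.bar :: clausesWord cs) := by
      simp [clausesWord]
    rw [e] at hM ⊢
    simp only [List.length_append, List.length_cons] at hM hj ⊢
    have h := ih (o := o ++ (c.map fun x => Key.lit (bitsOf L j) x.1 x.2).flatMap Key.word) (j + 1)
      (by omega) (by omega)
    refine Runs.congr (runs_read_literals (M := M) (T := _) (Runs.loop_cons (a := .bar) rfl
      (runs_inc (p := []) (fun S => Runs.skip S) (by omega)) h) (by simp; omega)) ?_ ?_
    · have : j + 1 + cs.length = j + (cs.length + 1) := by omega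
      simp [clauseKeys, this]
    · nlinarith

/-- Write the rule that guesses a value for the atoms `n` and `n + 1`, where `n` is given by `idx`. -/
def guessRule : Cmd Stk CNFSymbol :=
  copyIdx ;; emit [.pos] ;; copyIdx ;; emit [.tick, .pos, .bar, .bar, .bar]

theorem runs_guessRule {S : St} {n : ℕ} (h : S.idx = ticks (2 * n + 1)) (ht : S.tmp = [])
    (hM : 2 * n + 1 ≤ M) :
    Runs guessRule S { S with out := S.out ++ (Key.guess n).word } (10 * M + 12) := by
  refine Runs.congr ((runs_copyIdx h ht).seq ((runs_emit _ _).seq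
    ((runs_copyIdx (by exact h) (by exact ht)).seq (runs_emit _ _)))) ?_ ?_
  · simp [Key.word, Key.head, Key.pos, Key.neg, atomTicks, List.replicate_succ', ticks_append_cons]
  · simp only [List.length_cons, List.length_nil]
    omega

/-- Write the rules that saturate the atoms `n` and `n + 1`, where `n` is given by `idx`. -/
def satRules : Cmd Stk CNFSymbol :=
  copyIdx ;; emit [.pos, .bar, .pos, .bar, .bar] ;;
  copyIdx ;; emit [.tick, .pos, .bar, .pos, .bar, .bar]

theorem runs_satRules {S : St} {n : ℕ} (h : S.idx = ticks (2 * n + 1)) (ht : S.tmp = [])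
    (hM : 2 * n + 1 ≤ M) :
    Runs satRules S { S with out := S.out ++ (Key.satL n).word ++ (Key.satR n).word }
      (10 * M + 20) := by
  refine Runs.congr ((runs_copyIdx h ht).seq ((runs_emit _ _).seq
    ((runs_copyIdx (by exact h) (by exact ht)).seq (runs_emit _ _)))) ?_ ?_
  · simp [Key.word, Key.head, Key.pos, Key.neg, atomTicks, List.replicate_succ', ticks_append_cons]
  · simp only [List.length_cons, List.length_nil]
    omega

/-- Write the rules for the bits of the codes, and set all bits in `cnt` to zero. -/
def bitRules : Cmd Stk CNFSymbol :=
  .loop .cnt (fun _ => .push .cnt2 .neg ;; guessRule ;; satRules ;;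
    .push .idx .tick ;; .push .idx .tick) ;;
  restoreCnt

/-- Only the width of the counter matters here. Its old value is replaced by zero, the number of the
first clause. -/
theorem runs_bitRules (bs : List Bool) (hM : 2 * bs.length + 1 ≤ M) :
    Runs bitRules ⟨i, o, a, bs.map bitSymbol, [], ticks 1, [], [], []⟩
      ⟨i, o ++ ((List.range' 0 bs.length).flatMap
        (fun i => [Key.guess i, .satL i, .satR i])).flatMap Key.word, a,
        (bitsOf bs.length 0).map bitSymbol, [], ticks (2 * bs.length + 1), [], [], []⟩
      (bs.length * (20 * M + 38) + 2) := by
  have h₁ : ∀ (bs : List Bool) (n : ℕ) (o c2 : List CNFSymbol), 2 * (n + bs.length) + 1 ≤ M →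
      Runs (.loop .cnt (fun _ => .push .cnt2 .neg ;; guessRule ;; satRules ;;
          .push .idx .tick ;; .push .idx .tick))
        ⟨i, o, a, bs.map bitSymbol, c2, ticks (2 * n + 1), [], [], []⟩
        ⟨i, o ++ ((List.range' n bs.length).flatMap
          (fun i => [Key.guess i, .satL i, .satR i])).flatMap Key.word, a, [],
          List.replicate bs.length .neg ++ c2, ticks (2 * (n + bs.length) + 1), [], [], []⟩
        (bs.length * (20 * M + 36) + 1) := by
    intro bs
    induction bs with
    | nil => exact fun n o c2 h => Runs.congr (Runs.loop_nil rfl) (by simp) (by simp)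
    | cons b bs ih =>
      intro n o c2 h
      rw [List.length_cons] at h ⊢
      refine Runs.congr (Runs.loop_cons (by rfl) ((Runs.push _ _ _).seq
        ((runs_guessRule (M := M) (n := n) (by rfl) (by rfl) (by omega)).seq
        ((runs_satRules (M := M) (n := n) (by rfl) (by rfl) (by omega)).seq
        ((Runs.push _ _ _).seq (Runs.push _ _ _))))) (ih (n + 1) _ _ (by omega))) ?_ ?_
      · have : n + 1 + bs.length = n + (bs.length + 1) := by omega
        simp [this, List.range'_succ, List.replicate_succ', St.set, St.get]
      · rw [Nat.add_mul]; omega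
  refine Runs.congr ((h₁ bs 0 o [] (by omega)).seq (runs_restoreCnt _)) ?_ ?_
  · simp [bitsOf_zero, bitSymbol]
  · simp only [List.append_nil, List.length_replicate]
    nlinarith

/-- Write the rules that guess the values of the variables, and restore the input from `aux`. -/
def varRules : Cmd Stk CNFSymbol :=
  .loop .aux fun b => .push .inp b ;; guessRule ;; .push .idx .tick ;; .push .idx .tick

/-- The reversed input on `aux` is used as a unary counter, one variable per symbol; moving it back
undoes the reversal. -/
theorem runs_varRules (n : ℕ) {c : List CNFSymbol} (hM : 2 * (n + a.length) + 1 ≤ M) :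
    Runs varRules ⟨i, o, a, c, [], ticks (2 * n + 1), [], [], []⟩
      ⟨a.reverse ++ i, o ++ ((List.range' n a.length).map Key.guess).flatMap Key.word, [],
        c, [], ticks (2 * (n + a.length) + 1), [], [], []⟩
      (a.length * (10 * M + 16) + 1) := by
  induction a generalizing n i o with
  | nil => exact Runs.congr (Runs.loop_nil rfl) (by simp) (by simp)
  | cons b a ih =>
    rw [List.length_cons] at hM ⊢
    refine Runs.congr (Runs.loop_cons (by rfl) ((Runs.push _ _ _).seq
      ((runs_guessRule (M := M) (n := n) (by rfl) (by rfl) (by omega)).seq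
      ((Runs.push _ _ _).seq (Runs.push _ _ _)))) (ih (n + 1) (by omega))) ?_ ?_
    · have : n + 1 + a.length = n + (a.length + 1) := by omega
      simp [this, List.range'_succ, St.set, St.get]
    · rw [Nat.add_mul]; omega

/-- Write the rules for the unused codes. -/
def unusedRules : Cmd Stk CNFSymbol :=
  .push .aux .tick ;; .loop .aux (fun _ => unusedRule ;; inc .skip (.push .aux .tick)) ;; clearCnt

/-- The tick on `aux` keeps the loop alive. It is renewed by each increment without overflow, so the
loop ends right after the code of `2 ^ L - 1`. -/
theorem runs_unusedRules {j : ℕ} (hj : j < 2 ^ L) (hM : 2 * L + 1 ≤ M) :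
    Runs unusedRules ⟨i, o, [], (bitsOf L j).map bitSymbol, [], [], [], [], []⟩
      ⟨i, o ++ ((List.range' j (2 ^ L - j)).map fun j => Key.unused (bitsOf L j)).flatMap Key.word,
        [], [], [], [], [], [], []⟩
      (2 ^ L * (20 * (M + 1) ^ 2 + 3 * M + 10) + M + 10) := by
  have h₁ : ∀ (d j : ℕ) (o : List CNFSymbol), j + d + 1 = 2 ^ L →
      Runs (.loop .aux (fun _ => unusedRule ;; inc .skip (.push .aux .tick)))
        ⟨i, o, [.tick], (bitsOf L j).map bitSymbol, [], [], [], [], []⟩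
        ⟨i, o ++ ((List.range' j (d + 1)).map fun j => Key.unused (bitsOf L j)).flatMap Key.word,
          [], List.replicate L .neg, [], [], [], [], []⟩
        ((d + 1) * (20 * (M + 1) ^ 2 + 3 * M + 10) + 1) := by
    intro d
    induction d with
    | zero =>
      intro j o hd
      obtain rfl : j = 2 ^ L - 1 := by omega
      refine Runs.congr (Runs.loop_cons (by rfl)
        ((runs_unusedRule (M := M) _ _ _ (by simpa using hM)).seq
        (runs_inc_overflow (q := []) (fun S => Runs.skip S))) (Runs.loop_nil (by rfl))) ?_ (by omega)
      simp
    | succ d ih =>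
      intro j o hd
      refine Runs.congr (Runs.loop_cons (by rfl)
        ((runs_unusedRule (M := M) _ _ _ (by simpa using hM)).seq
        (runs_inc (p := [.tick]) (fun S => Runs.push _ _ _) (by omega)))
        (ih (j + 1) _ (by omega))) ?_ ?_
      · simp [List.range'_succ]
      · rw [Nat.add_mul (d + 1)]; omega
  obtain ⟨d, hd⟩ : ∃ d, j + d + 1 = 2 ^ L := ⟨2 ^ L - j - 1, by omega⟩
  have e : 2 ^ L - j = d + 1 := by omega
  rw [e]
  refine Runs.congr ((Runs.push _ _ _).seq ((h₁ d j o hd).seq (runs_clearCnt _))) rfl ?_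
  have := Nat.mul_le_mul_right (20 * (M + 1) ^ 2 + 3 * M + 10) (show d + 1 ≤ 2 ^ L by omega)
  simp only [List.length_replicate]
  omega

/-! ### The number of bits and the whole translation -/

/-- Move the input to `aux`, and count its symbols in `cnt`. -/
def countInput : Cmd Stk CNFSymbol :=
  .loop .inp fun b => .push .aux b ;; inc (.push .cnt .pos) .skip

/-- The invariant `j < 2 ^ L ≤ 2 * j + 1` says that the counter is no wider than necessary: it gains
a bit only on overflow. This keeps `2 ^ L` linear in the length of the input. -/
theorem runs_countInput {L j : ℕ} (h₁ : j < 2 ^ L) (h₂ : 2 ^ L ≤ 2 * j + 1)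
    (hM : 2 * (j + i.length) + 1 ≤ M) :
    ∃ L', j + i.length < 2 ^ L' ∧ 2 ^ L' ≤ 2 * (j + i.length) + 1 ∧
      Runs countInput ⟨i, o, a, (bitsOf L j).map bitSymbol, [], [], [], [], []⟩
        ⟨[], o, i.reverse ++ a, (bitsOf L' (j + i.length)).map bitSymbol, [], [], [], [], []⟩
        (i.length * (6 * M + 10) + 1) := by
  induction i generalizing j L a with
  | nil => exact ⟨L, h₁, h₂, Runs.congr (Runs.loop_nil rfl) (by simp) (by simp)⟩
  | cons b i ih =>
    rw [List.length_cons] at hM ⊢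
    have hL : L < M := by have := Nat.lt_two_pow_self (n := L); omega
    have e : j + 1 + i.length = j + (i.length + 1) := by omega
    by_cases hj : j + 1 < 2 ^ L
    · obtain ⟨L', h₁', h₂', h⟩ := ih (L := L) (j := j + 1) (a := b :: a) hj (by omega) (by omega)
      rw [e] at h₁' h₂' h
      refine ⟨L', h₁', h₂', Runs.congr (Runs.loop_cons (by rfl) ((Runs.push _ _ _).seq
        (runs_inc (p := []) (fun S => Runs.skip S) hj)) h) (by simp) ?_⟩
      rw [Nat.add_mul]; omega
    · obtain ⟨L', h₁', h₂', h⟩ := ih (L := L + 1) (j := j + 1) (a := b :: a)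
        (by rw [pow_succ]; omega) (by rw [pow_succ]; omega) (by omega)
      rw [e] at h₁' h₂' h
      obtain rfl : j = 2 ^ L - 1 := by omega
      have e' : (bitsOf (L + 1) (2 ^ L - 1 + 1)).map bitSymbol =
          List.replicate L CNFSymbol.neg ++ [.pos] := by
        rw [Nat.sub_add_cancel (by omega), bitsOf_succ_two_pow]; simp [bitSymbol]
      rw [e'] at h
      refine ⟨L', h₁', h₂', Runs.congr (Runs.loop_cons (by rfl) ((Runs.push _ _ _).seq
        (runs_inc_overflow (q := [.pos]) (fun S => Runs.push _ _ _))) h) (by simp) ?_⟩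
      rw [Nat.add_mul]; omega

/-- The command that translates formulas into programs. -/
def translateCNF : Cmd Stk CNFSymbol :=
  countInput ;; .push .idx .tick ;; emit [.bar, .bar, .pos, .bar] ;; bitRules ;; varRules ;;
  clearIdx ;; .loop .inp readSymbol ;; unusedRules

theorem length_le_length_clausesWord (cs : List (List Literal)) :
    cs.length ≤ (clausesWord cs).length := by
  induction cs with
  | nil => simp
  | cons c cs ih => simp [clausesWord] at ih ⊢; omega

theorem runs_translateCNF (cs : List (List Literal)) {B : ℕ} (hB : (clausesWord cs).length = B) :
    ∃ L, B < 2 ^ L ∧ 2 ^ L ≤ 2 * B + 1 ∧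
      Runs translateCNF ⟨clausesWord cs, [], [], [], [], [], [], [], []⟩
        ⟨[], (allKeys L B cs).flatMap Key.word, [], [], [], [], [], [], []⟩
        (20000 * (B + 2) ^ 3) := by
  -- `M = 6 * B + 12` serves all phases: since `L ≤ 2 * B`, it exceeds the largest requirement, `2 *
  -- (L + B) + 8`.
  obtain ⟨L, h₁, h₂, h⟩ := runs_countInput (M := 6 * B + 12) (L := 0) (j := 0)
    (i := clausesWord cs) (o := []) (a := []) (by simp) (by simp) (by omega)
  have hc := length_le_length_clausesWord cs
  simp only [hB, Nat.zero_add, List.append_nil] at h₁ h₂ h hc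
  have hL : L < 2 * B + 1 := lt_of_lt_of_le Nat.lt_two_pow_self h₂
  set o₁ := Key.constr.word with ho₁
  set o₂ := o₁ ++ ((List.range' 0 L).flatMap
    (fun i => [Key.guess i, .satL i, .satR i])).flatMap Key.word with ho₂
  set o₃ := o₂ ++ ((List.range' L B).map Key.guess).flatMap Key.word with ho₃
  set o₄ := o₃ ++ (clauseKeys L 0 cs).flatMap Key.word with ho₄
  have e₂ : Runs bitRules
      ⟨[], o₁, (clausesWord cs).reverse, (bitsOf L B).map bitSymbol, [], ticks 1, [], [], []⟩
      ⟨[], o₂, (clausesWord cs).reverse, (bitsOf L 0).map bitSymbol, [], ticks (2 * L + 1), [], [],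
        []⟩ (L * (20 * (6 * B + 12) + 38) + 2) := by
    have := runs_bitRules (M := 6 * B + 12) (i := []) (o := o₁) (a := (clausesWord cs).reverse)
      (bitsOf L B) (by rw [length_bitsOf]; omega)
    rwa [length_bitsOf] at this
  have e₃ : Runs varRules
      ⟨[], o₂, (clausesWord cs).reverse, (bitsOf L 0).map bitSymbol, [], ticks (2 * L + 1), [], [],
        []⟩
      ⟨clausesWord cs, o₃, [], (bitsOf L 0).map bitSymbol, [], ticks (2 * (L + B) + 1), [], [], []⟩
      (B * (10 * (6 * B + 12) + 16) + 1) := by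
    have := runs_varRules (M := 6 * B + 12) (i := []) (o := o₂) (a := (clausesWord cs).reverse) L
      (c := (bitsOf L 0).map bitSymbol) (by rw [List.length_reverse, hB]; omega)
    rwa [List.length_reverse, hB, List.reverse_reverse, List.append_nil] at this
  have e₄ := runs_read_clauses (M := 6 * B + 12) (L := L) (o := o₃) (a := []) cs 0 (by omega)
    (by omega)
  rw [hB, Nat.zero_add, ← ho₄] at e₄
  have e₅ := runs_unusedRules (M := 6 * B + 12) (L := L) (i := []) (o := o₄) (j := cs.length)
    (by omega) (by omega)
  refine ⟨L, h₁, h₂, Runs.congr (h.seq ((Runs.push _ .idx .tick).seq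
    ((runs_emit [.bar, .bar, .pos, .bar] _).seq (e₂.seq (e₃.seq ((runs_clearIdx (by rfl)).seq
      (e₄.seq e₅))))))) ?_ ?_⟩
  · simp [allKeys, ho₁, ho₂, ho₃, ho₄]
  · have e₁ : L * (20 * (6 * B + 12) + 38) ≤ (2 * B + 1) * (20 * (6 * B + 12) + 38) :=
      Nat.mul_le_mul_right _ hL.le
    have e₂ := Nat.mul_le_mul_right
      (20 * (6 * B + 12 + 1) ^ 2 + 3 * (6 * B + 12) + 10) h₂
    simp only [List.length_cons, List.length_nil]
    nlinarith

end

/-! ### The program of a formula -/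

theorem mem_codeAtoms {o a : ℕ} {b : List Bool} :
    a ∈ codeAtoms o b ↔ ∃ i, ∃ h : i < b.length, a = o + 2 * i + (b[i]).toNat := by
  induction b generalizing o with
  | nil => simp [codeAtoms]
  | cons x b ih =>
    rw [codeAtoms, List.mem_cons, ih]
    constructor
    · rintro (rfl | ⟨i, h, rfl⟩)
      · exact ⟨0, by simp, by simp⟩
      · exact ⟨i + 1, by simpa using h, by simp; omega⟩
    · rintro ⟨i, h, rfl⟩
      cases i with
      | zero => exact .inl (by simp)
      | succ i => exact .inr ⟨i, by simpa using h, by simp; omega⟩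

theorem bounds_of_mem_codeAtoms {o a : ℕ} {b : List Bool} (h : a ∈ codeAtoms o b) :
    o ≤ a ∧ a < o + 2 * b.length := by
  obtain ⟨i, hi, rfl⟩ := mem_codeAtoms.1 h
  have := Bool.toNat_lt (b[i])
  omega

theorem nodup_codeAtoms (o : ℕ) (b : List Bool) : (codeAtoms o b).Nodup := by
  induction b generalizing o with
  | nil => exact List.nodup_nil
  | cons x b ih =>
    refine List.nodup_cons.2 ⟨fun h => ?_, ih _⟩
    have := (bounds_of_mem_codeAtoms h).1
    have := Bool.toNat_lt x
    omega

/-- Inclusion suffices, as both sides have exactly one atom per bit. Hence a set with one atom for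
each bit contains a single code. -/
theorem codeAtoms_injective {o : ℕ} {b b' : List Bool} (hl : b.length = b'.length)
    (h : ∀ a ∈ codeAtoms o b, a ∈ codeAtoms o b') : b = b' := by
  refine List.ext_getElem hl fun i hi hi' => ?_
  obtain ⟨k, hk, e⟩ := mem_codeAtoms.1 (h _ (mem_codeAtoms.2 ⟨i, hi, rfl⟩))
  have h₁ := Bool.toNat_lt (b[i])
  have h₂ := Bool.toNat_lt (b'[k])
  obtain rfl : i = k := by omega
  cases hb : b[i] <;> cases hb' : b'[i] <;> simp_all

/-! ### Distinct keys give distinct rules -/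

namespace Key

/-- The rule with the given key. -/
def toRule (k : Key) : Rule where
  head := k.head.toFinset
  pos := k.pos.toFinset
  neg := k.neg.toFinset
  head_pos := by
    rw [Finset.disjoint_left]
    intro a h₁ h₂
    rw [List.mem_toFinset] at h₁ h₂
    rcases k with _ | i | i | i | ⟨b, v, _ | _⟩ | b <;> simp [head, pos] at h₁ h₂
    · omega
    · omega
    · have := bounds_of_mem_codeAtoms h₂; omega
    · rcases h₂ with h₂ | h₂
      · have := bounds_of_mem_codeAtoms h₂; omega
      · omega
    · have := bounds_of_mem_codeAtoms h₂; omega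
  head_neg := by
    rw [Finset.disjoint_left]
    intro a h₁ h₂
    rw [List.mem_toFinset] at h₁ h₂
    rcases k with _ | i | i | i | ⟨b, v, _ | _⟩ | b <;> simp [head, neg] at h₁ h₂
    omega
  pos_neg := by
    rw [Finset.disjoint_left]
    intro a h₁ h₂
    rw [List.mem_toFinset] at h₁ h₂
    rcases k with _ | i | i | i | ⟨b, v, _ | _⟩ | b <;> simp [pos, neg] at h₁ h₂
    have := bounds_of_mem_codeAtoms h₁; omega

/-- The codes in the key have length `L`. -/
def HasLength (L : ℕ) : Key → Prop
  | lit b _ _ => b.length = L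
  | unused b => b.length = L
  | _ => True

/-- Needed because the output must list rules without repetition. The common length is essential:
`lit b 0 true` and `unused (b ++ [false])` have the same rule. -/
theorem toRule_injOn {L : ℕ} {k k' : Key} (hk : k.HasLength L) (hk' : k'.HasLength L)
    (h : k.toRule = k'.toRule) : k = k' := by
  have h₁ : ∀ a, a ∈ k.head ↔ a ∈ k'.head := fun a => by
    simpa [toRule] using Finset.ext_iff.1 (congrArg Rule.head h) a
  have h₂ : ∀ a, a ∈ k.pos ↔ a ∈ k'.pos := fun a => by
    simpa [toRule] using Finset.ext_iff.1 (congrArg Rule.pos h) a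
  have h₃ : ∀ a, a ∈ k.neg ↔ a ∈ k'.neg := fun a => by
    simpa [toRule] using Finset.ext_iff.1 (congrArg Rule.neg h) a
  rcases k with _ | i | i | i | ⟨b, v, s⟩ | b <;>
    rcases k' with _ | i' | i' | i' | ⟨b', v', s'⟩ | b' <;>
    simp only [head, List.mem_cons, List.not_mem_nil, or_false, false_iff, iff_false, forall_eq,
      not_or, HasLength] at h₁ hk hk'
  -- The heads settle every pair of kinds except those among `lit` and `unused`, which share the
  -- head `{0}`.
  all_goals first
    | rfl
    | (exfalso; have := h₁ 0; omega)
    | (exfalso; have := h₁ (2 * i + 1); have := h₁ (2 * i + 2); omega)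
    | (exfalso; have := h₁ (2 * i' + 1); have := h₁ (2 * i' + 2); omega)
    | (obtain rfl : i = i' := by have := h₁ (2 * i + 1); have := h₁ (2 * i + 2); omega
       rfl)
    | skip
  · have hb : ∀ a, a ∈ codeAtoms 1 b → a < 2 * (b.length + v') + 1 := fun a ha => by
      have := bounds_of_mem_codeAtoms ha; omega
    have hb' : ∀ a, a ∈ codeAtoms 1 b' → a < 2 * (b'.length + v) + 1 := fun a ha => by
      have := bounds_of_mem_codeAtoms ha; omega
    rw [hk] at hb
    rw [hk'] at hb'
    -- The atom of the literal lies above all code atoms, so it can be recognized in the body.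
    have hv : s = s' ∧ v = v' := by
      cases s <;> cases s' <;> simp only [neg, pos, List.mem_append, List.mem_singleton,
        List.not_mem_nil, iff_false, false_iff, hk, hk'] at h₂ h₃
      · have := h₃ (2 * (L + v) + 1)
        exact ⟨rfl, by omega⟩
      · have := h₃ (2 * (L + v) + 1)
        omega
      · have := h₃ (2 * (L + v') + 1)
        omega
      · have h := (h₂ (2 * (L + v) + 1)).1 (.inr rfl)
        rcases h with h | h
        · have := hb' _ h; omega
        · exact ⟨rfl, by omega⟩
    obtain ⟨rfl, rfl⟩ := hv
    obtain rfl : b = b' := by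
      refine codeAtoms_injective (o := 1) (hk.trans hk'.symm) fun a ha => ?_
      cases s <;> simp only [pos, List.mem_append, List.mem_singleton, hk, hk'] at h₂
      · exact (h₂ a).1 ha
      · refine ((h₂ a).1 (.inl ha)).resolve_right fun h => ?_
        have := hb a ha; omega
    rfl
  · exfalso
    cases s
    · simpa [neg] using h₃ (2 * (b.length + v) + 1)
    · have := bounds_of_mem_codeAtoms ((h₂ (2 * (b.length + v) + 1)).1 (by simp [pos]))
      omega
  · exfalso
    cases s'
    · simpa [neg] using h₃ (2 * (b'.length + v') + 1)
    · have := bounds_of_mem_codeAtoms ((h₂ (2 * (b'.length + v') + 1)).2 (by simp [pos]))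
      omega
  · rw [codeAtoms_injective (o := 1) (hk.trans hk'.symm) fun a ha => (h₂ a).1 ha]

theorem nodup_head (k : Key) : k.head.Nodup := by
  cases k <;> simp [head]

theorem nodup_pos (k : Key) : k.pos.Nodup := by
  rcases k with _ | i | i | i | ⟨b, v, _ | _⟩ | b <;> simp [pos, nodup_codeAtoms]
  rw [List.nodup_append]
  refine ⟨nodup_codeAtoms _ _, by simp, fun a ha c hc => ?_⟩
  have := bounds_of_mem_codeAtoms ha
  simp at hc
  omega

theorem nodup_neg (k : Key) : k.neg.Nodup := by
  rcases k with _ | i | i | i | ⟨b, v, _ | _⟩ | b <;> simp [neg]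

end Key

theorem mem_clauseKeys {L j : ℕ} {cs : List (List Literal)} {k : Key} :
    k ∈ clauseKeys L j cs ↔
      ∃ i, ∃ h : i < cs.length, ∃ l ∈ cs[i], k = .lit (bitsOf L (j + i)) l.1 l.2 := by
  induction cs generalizing j with
  | nil => simp [clauseKeys]
  | cons c cs ih =>
    rw [clauseKeys, List.mem_append, ih, List.mem_map]
    constructor
    · rintro (⟨l, hl, rfl⟩ | ⟨i, h, l, hl, rfl⟩)
      · exact ⟨0, by simp, l, hl, rfl⟩
      · exact ⟨i + 1, by simpa using h, l, hl, by rw [Nat.add_assoc, Nat.add_comm 1]⟩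
    · rintro ⟨i, h, l, hl, rfl⟩
      cases i with
      | zero => exact .inl ⟨l, hl, rfl⟩
      | succ i =>
        exact .inr ⟨i, by simpa using h, l, hl, by rw [Nat.add_assoc j 1, Nat.add_comm 1]⟩

theorem mem_allKeys {L B : ℕ} {cs : List (List Literal)} {k : Key} : k ∈ allKeys L B cs ↔
    k = .constr ∨ (∃ i < L + B, k = .guess i) ∨ (∃ i < L, k = .satL i ∨ k = .satR i) ∨
      (∃ j, ∃ h : j < cs.length, ∃ l ∈ cs[j], k = .lit (bitsOf L j) l.1 l.2) ∨
      ∃ j, cs.length ≤ j ∧ j < 2 ^ L ∧ k = .unused (bitsOf L j) := by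
  have h₁ : (∃ i < L + B, k = .guess i) ↔
      (∃ i < L, k = .guess i) ∨ ∃ i, (L ≤ i ∧ i < L + B) ∧ k = .guess i := by
    constructor
    · rintro ⟨i, hi, rfl⟩
      rcases lt_or_ge i L with h | h
      · exact .inl ⟨i, h, rfl⟩
      · exact .inr ⟨i, ⟨h, hi⟩, rfl⟩
    · rintro (⟨i, hi, rfl⟩ | ⟨i, ⟨-, hi⟩, rfl⟩)
      · exact ⟨i, by omega, rfl⟩
      · exact ⟨i, hi, rfl⟩
  have h₂ : ∀ j, j < cs.length + (2 ^ L - cs.length) ∧ cs.length ≤ j ↔ cs.length ≤ j ∧ j < 2 ^ L := by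
    intro j; omega
  rw [h₁]
  simp only [allKeys, List.mem_cons, List.mem_append, List.mem_flatMap, List.mem_map,
    List.mem_range'_1, mem_clauseKeys, Nat.zero_add, Nat.zero_le, true_and, List.not_mem_nil,
    or_false]
  constructor
  · rintro (h | (((⟨i, hi, h | h | h⟩ | ⟨i, hi, rfl⟩) | h) | ⟨j, hj, rfl⟩))
    · exact .inl h
    · exact .inr (.inl (.inl ⟨i, hi, h⟩))
    · exact .inr (.inr (.inl ⟨i, hi, .inl h⟩))
    · exact .inr (.inr (.inl ⟨i, hi, .inr h⟩))
    · exact .inr (.inl (.inr ⟨i, hi, rfl⟩))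
    · exact .inr (.inr (.inr (.inl h)))
    · exact .inr (.inr (.inr (.inr ⟨j, by omega, by omega, rfl⟩)))
  · rintro (h | ((⟨i, hi, h⟩ | ⟨i, hi, rfl⟩) | (⟨i, hi, h | h⟩ | (h | ⟨j, hj, hj', rfl⟩))))
    · exact .inl h
    · exact .inr (.inl (.inl (.inl ⟨i, hi, .inl h⟩)))
    · exact .inr (.inl (.inl (.inr ⟨i, hi, rfl⟩)))
    · exact .inr (.inl (.inl (.inl ⟨i, hi, .inr (.inl h)⟩)))
    · exact .inr (.inl (.inl (.inl ⟨i, hi, .inr (.inr h)⟩)))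
    · exact .inr (.inl (.inr h))
    · exact .inr (.inr ⟨j, by omega, rfl⟩)

theorem nodup_clauseKeys {L j : ℕ} {cs : List (List Literal)} (hcs : ∀ c ∈ cs, c.Nodup)
    (hj : j + cs.length ≤ 2 ^ L) : (clauseKeys L j cs).Nodup := by
  induction cs generalizing j with
  | nil => exact List.nodup_nil
  | cons c cs ih =>
    rw [List.length_cons] at hj
    rw [clauseKeys, List.nodup_append]
    refine ⟨(hcs c (by simp)).map fun x y h => ?_, ih (fun c hc => hcs c (by simp [hc])) (by omega),
      fun a ha b hb => ?_⟩
    · simp only [Key.lit.injEq, true_and] at h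
      exact Prod.ext h.1 h.2
    · rintro rfl
      obtain ⟨l, -, rfl⟩ := List.mem_map.1 ha
      obtain ⟨i, hi, l', -, h⟩ := mem_clauseKeys.1 hb
      simp only [Key.lit.injEq] at h
      have := bitsOf_injOn (by omega) (by omega) h.1
      omega

theorem nodup_allKeys {L B : ℕ} {cs : List (List Literal)} (hcs : ∀ c ∈ cs, c.Nodup)
    (hL : cs.length ≤ 2 ^ L) : (allKeys L B cs).Nodup := by
  have h₁ : ((List.range' 0 L).flatMap
      fun i => [Key.guess i, .satL i, .satR i]).Nodup := by
    rw [List.nodup_flatMap]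
    refine ⟨fun i _ => by simp, (List.nodup_range' (s := 0) (n := L)).imp fun {i j} hij => ?_⟩
    simp [Function.onFun, List.disjoint_left]
    grind
  have h₂ : ((List.range' L B).map Key.guess).Nodup :=
    List.Nodup.map (fun x y h => by simpa using h) (List.nodup_range' ..)
  have h₃ : ((List.range' cs.length (2 ^ L - cs.length)).map
      fun j => Key.unused (bitsOf L j)).Nodup := by
    refine List.Nodup.map_on (fun x hx y hy h => ?_) (List.nodup_range' ..)
    rw [List.mem_range'_1] at hx hy
    exact bitsOf_injOn (L := L) (by omega) (by omega) (by simpa using h)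
  have h₄ := nodup_clauseKeys (j := 0) hcs (L := L) (by omega)
  rw [allKeys, List.nodup_cons, List.nodup_append, List.nodup_append, List.nodup_append]
  refine ⟨?_, ⟨⟨h₁, h₂, ?_⟩, h₄, ?_⟩, h₃, ?_⟩
  · simp [mem_clauseKeys]
  · intro a ha b hb hab
    simp at ha hb
    grind
  · intro a ha b hb hab
    simp [mem_clauseKeys] at ha hb
    grind
  · intro a ha b hb hab
    simp [mem_clauseKeys] at ha hb
    grind

/-- The program of a formula that is given as a list of clauses. -/
def cnfProgram (L B : ℕ) (cs : List (List Literal)) : Program :=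
  ((allKeys L B cs).map Key.toRule).toFinset

theorem mem_cnfProgram {L B : ℕ} {cs : List (List Literal)} {r : Rule} :
    r ∈ cnfProgram L B cs ↔ ∃ k ∈ allKeys L B cs, k.toRule = r := by
  simp [cnfProgram]

theorem hasLength_of_mem_allKeys {L B : ℕ} {cs : List (List Literal)} {k : Key}
    (h : k ∈ allKeys L B cs) : k.HasLength L := by
  rcases mem_allKeys.1 h with rfl | ⟨i, -, rfl⟩ | ⟨i, -, rfl | rfl⟩ | ⟨j, -, l, -, rfl⟩ |
    ⟨j, -, -, rfl⟩ <;> simp [Key.HasLength]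

theorem Key.mem_atoms_toRule {k : Key} {a : ℕ} :
    a ∈ k.toRule.atoms ↔ a ∈ k.head ∨ a ∈ k.pos ∨ a ∈ k.neg := by
  simp [Key.toRule, Rule.atoms]

/-- The encoding demands a gapless numbering. The guess rules supply every atom but `0`, which
occurs in the constraint. -/
theorem atoms_cnfProgram {L B : ℕ} {cs : List (List Literal)}
    (hB : ∀ c ∈ cs, ∀ l ∈ c, l.1 < B) :
    (cnfProgram L B cs).atoms = Finset.range (2 * (L + B) + 1) := by
  ext a
  simp only [Program.atoms, Finset.mem_biUnion, mem_cnfProgram, Finset.mem_range]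
  constructor
  · rintro ⟨_, ⟨k, hk, rfl⟩, ha⟩
    rw [Key.mem_atoms_toRule] at ha
    rcases mem_allKeys.1 hk with rfl | ⟨i, hi, rfl⟩ | ⟨i, hi, rfl | rfl⟩ | ⟨j, hj, l, hl, rfl⟩ |
      ⟨j, -, -, rfl⟩
    · simp [Key.head, Key.pos, Key.neg] at ha; omega
    · simp [Key.head, Key.pos, Key.neg] at ha; omega
    · simp [Key.head, Key.pos, Key.neg] at ha; omega
    · simp [Key.head, Key.pos, Key.neg] at ha; omega
    · have h₁ := hB _ (List.getElem_mem hj) l hl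
      have h₂ : a ∈ codeAtoms 1 (bitsOf L j) → a < 2 * (L + B) + 1 := fun h => by
        have := bounds_of_mem_codeAtoms h
        rw [length_bitsOf] at this
        omega
      rcases l with ⟨v, _ | _⟩ <;> simp [Key.head, Key.pos, Key.neg] at ha h₁
      · rcases ha with ha | ha | ha
        · omega
        · exact h₂ ha
        · omega
      · rcases ha with ha | ha | ha
        · omega
        · exact h₂ ha
        · omega
    · simp [Key.head, Key.pos, Key.neg] at ha
      rcases ha with ha | ha
      · omega
      · have := bounds_of_mem_codeAtoms ha
        rw [length_bitsOf] at this
        omega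
  · intro ha
    rcases Nat.eq_zero_or_pos a with rfl | h
    · exact ⟨_, ⟨.constr, mem_allKeys.2 (.inl rfl), rfl⟩, Key.mem_atoms_toRule.2 (by simp [Key.neg])⟩
    · refine ⟨_, ⟨.guess ((a - 1) / 2), mem_allKeys.2 (.inr (.inl ⟨_, by omega, rfl⟩)), rfl⟩,
        Key.mem_atoms_toRule.2 (.inl ?_)⟩
      simp only [Key.head, List.mem_cons, List.not_mem_nil, or_false]
      omega

/-- The program symbol that is represented by a symbol of the output of the translation. -/
def toProgramSymbol : CNFSymbol → ProgramSymbol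
  | .tick => .tick
  | .pos => .atom
  | _ => .bar

theorem map_atomTicks (l : List ℕ) : (atomTicks l).map toProgramSymbol = atomsWord l := by
  simp [atomTicks, atomsWord, List.map_flatMap, toProgramSymbol]

theorem Key.toRule_encodedBy (k : Key) : k.toRule.EncodedBy (k.word.map toProgramSymbol) := by
  refine ⟨k.head, k.pos, k.neg, ?_, ?_, ?_, ?_⟩
  · simp [toRule, k.nodup_head.dedup]
  · simp [toRule, k.nodup_pos.dedup]
  · simp [toRule, k.nodup_neg.dedup]
  · simp only [word, List.map_append, map_atomTicks]
    rfl

theorem cnfProgram_encodedBy {L B : ℕ} {cs : List (List Literal)} (hcs : ∀ c ∈ cs, c.Nodup)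
    (hL : cs.length ≤ 2 ^ L) (hB : ∀ c ∈ cs, ∀ l ∈ c, l.1 < B) :
    (cnfProgram L B cs).EncodedBy (((allKeys L B cs).flatMap Key.word).map toProgramSymbol) := by
  refine ⟨by rw [atoms_cnfProgram hB, Finset.card_range], (allKeys L B cs).map Key.toRule,
    (allKeys L B cs).map fun k => k.word.map toProgramSymbol, ?_, ?_, ?_⟩
  · have : ((allKeys L B cs).map Key.toRule).Nodup :=
      (nodup_allKeys hcs hL).map_on fun x hx y hy h =>
        Key.toRule_injOn (hasLength_of_mem_allKeys hx) (hasLength_of_mem_allKeys hy) h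
    simp [cnfProgram, this.dedup]
  · simp [List.forall₂_map_left_iff, List.forall₂_map_right_iff, List.forall₂_same,
      Key.toRule_encodedBy]
  · rw [List.map_flatMap, List.flatMap_def]

/-! ### Correctness of the reduction -/

theorem hasModel_reduct_iff {P : Program} {I J : Finset ℕ} : (P.reduct I).HasModel J ↔
    ∀ r ∈ P, Disjoint r.neg I → r.pos ⊆ J → ∃ a ∈ r.head, a ∈ J := by
  simp only [Program.reduct, Program.HasModel, Finset.forall_mem_image, Finset.mem_filter,
    Rule.SatisfiedBy, Rule.dropNeg, Finset.union_empty, Finset.sdiff_nonempty, and_imp]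
  refine forall₃_congr fun r _ _ => ?_
  rw [or_iff_not_imp_right, not_not]
  simp [Finset.Nonempty]

/-- Negative literals are evaluated in the candidate `I`, by the reduct, and positive ones in `J`.
-/
theorem hasModel_reduct_cnfProgram {L B : ℕ} {cs : List (List Literal)} {I J : Finset ℕ} :
    ((cnfProgram L B cs).reduct I).HasModel J ↔
      0 ∈ I ∧ (∀ i < L + B, 2 * i + 1 ∈ J ∨ 2 * i + 2 ∈ J) ∧
      (∀ i < L, 0 ∈ J → 2 * i + 1 ∈ J ∧ 2 * i + 2 ∈ J) ∧
      (∀ j, ∀ h : j < cs.length, ∀ l ∈ cs[j],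
        (if l.2 then 2 * (L + l.1) + 1 ∈ J else 2 * (L + l.1) + 1 ∉ I) →
        (∀ a ∈ codeAtoms 1 (bitsOf L j), a ∈ J) → 0 ∈ J) ∧
      ∀ j, cs.length ≤ j → j < 2 ^ L → (∀ a ∈ codeAtoms 1 (bitsOf L j), a ∈ J) → 0 ∈ J := by
  have key : ((cnfProgram L B cs).reduct I).HasModel J ↔ ∀ k ∈ allKeys L B cs,
      (∀ a ∈ k.neg, a ∉ I) → (∀ a ∈ k.pos, a ∈ J) → ∃ a ∈ k.head, a ∈ J := by
    simp only [hasModel_reduct_iff, mem_cnfProgram, forall_exists_index, and_imp,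
      forall_apply_eq_imp_iff₂]
    refine forall₂_congr fun k _ => ?_
    simp [Key.toRule, Finset.disjoint_left, Finset.subset_iff]
  rw [key]
  constructor
  · intro h
    refine ⟨?_, fun i hi => ?_, fun i hi h0 => ⟨?_, ?_⟩, fun j hj l hl hlit hc => ?_,
      fun j hj hj' hc => ?_⟩
    · by_contra h0
      simpa [Key.head, Key.pos, Key.neg, h0] using h .constr (mem_allKeys.2 (.inl rfl))
    · simpa [Key.head, Key.pos, Key.neg] using h (.guess i) (mem_allKeys.2 (.inr (.inl ⟨i, hi, rfl⟩)))
    · simpa [Key.head, Key.pos, Key.neg, h0] using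
        h (.satL i) (mem_allKeys.2 (.inr (.inr (.inl ⟨i, hi, .inl rfl⟩))))
    · simpa [Key.head, Key.pos, Key.neg, h0] using
        h (.satR i) (mem_allKeys.2 (.inr (.inr (.inl ⟨i, hi, .inr rfl⟩))))
    · have := h (.lit (bitsOf L j) l.1 l.2)
        (mem_allKeys.2 (.inr (.inr (.inr (.inl ⟨j, hj, l, hl, rfl⟩)))))
      rcases l with ⟨v, _ | _⟩
      · simp at hlit
        simp [Key.head, Key.pos, Key.neg, hlit] at this
        exact this hc
      · simp at hlit
        simp [Key.head, Key.pos, Key.neg, or_imp, forall_and, hlit] at this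
        exact this hc
    · have := h (.unused (bitsOf L j))
        (mem_allKeys.2 (.inr (.inr (.inr (.inr ⟨j, hj, hj', rfl⟩)))))
      simp [Key.head, Key.pos, Key.neg] at this
      exact this hc
  · rintro ⟨h₁, h₂, h₃, h₄, h₅⟩ k hk
    rcases mem_allKeys.1 hk with rfl | ⟨i, hi, rfl⟩ | ⟨i, hi, rfl | rfl⟩ | ⟨j, hj, l, hl, rfl⟩ |
      ⟨j, hj, hj', rfl⟩
    · simp [Key.neg, h₁]
    · simpa [Key.head, Key.pos, Key.neg] using h₂ i hi
    · simpa [Key.head, Key.pos, Key.neg] using fun h => (h₃ i hi h).1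
    · simpa [Key.head, Key.pos, Key.neg] using fun h => (h₃ i hi h).2
    · have := h₄ j hj l hl
      rcases l with ⟨v, _ | _⟩
      · simpa [Key.head, Key.pos, Key.neg] using this
      · simp [Key.head, Key.pos, Key.neg, or_imp, forall_and] at this ⊢
        exact fun hc hv => this hv hc
    · simpa [Key.head, Key.pos, Key.neg] using h₅ j hj hj'

/-- If the assignment read off from `I` falsifies clause `j`, then dropping `0` and keeping only the
code of `j` among the bit atoms leaves a smaller model of the reduct: no other code is contained in
it, and no literal of clause `j` fires. -/
theorem satisfiable_of_consistent {L B : ℕ} {cs : List (List Literal)} (hL : cs.length ≤ 2 ^ L)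
    (h : (cnfProgram L B cs).Consistent) :
    ∃ τ : ℕ → Bool, ∀ c ∈ cs, ∃ l ∈ c, τ l.1 = l.2 := by
  obtain ⟨I, hI, hmin⟩ := h
  obtain ⟨h₁, h₂, h₃, h₄, h₅⟩ := hasModel_reduct_cnfProgram.1 hI
  refine ⟨fun v => decide (2 * (L + v) + 1 ∈ I), fun c hc => ?_⟩
  obtain ⟨j, hj, rfl⟩ := List.mem_iff_getElem.1 hc
  by_contra! hno
  set J : Finset ℕ := I.filter (2 * L < ·) ∪ (codeAtoms 1 (bitsOf L j)).toFinset with hJdef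
  have hJ : ∀ a, a ∈ J ↔ a ∈ I ∧ 2 * L < a ∨ a ∈ codeAtoms 1 (bitsOf L j) := by simp [hJdef]
  have hcode : ∀ {a i}, a ∈ codeAtoms 1 (bitsOf L i) → 0 < a ∧ a ≤ 2 * L := fun {a i} h => by
    have := bounds_of_mem_codeAtoms h
    rw [length_bitsOf] at this
    omega
  have h0 : 0 ∉ J := fun h => by
    rcases (hJ 0).1 h with h | h
    · omega
    · exact absurd (hcode h).1 (by omega)
  have hcodeJ : ∀ i, i < 2 ^ L → (∀ a ∈ codeAtoms 1 (bitsOf L i), a ∈ J) → i = j := by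
    intro i hi h
    refine bitsOf_injOn hi (by omega) (codeAtoms_injective (o := 1) (by simp) fun a ha => ?_)
    rcases (hJ a).1 (h a ha) with h' | h'
    · exact absurd (hcode ha).2 (by omega)
    · exact h'
  have hJI : J ⊆ I := by
    intro a ha
    rcases (hJ a).1 ha with h | h
    · exact h.1
    · obtain ⟨i, hi, rfl⟩ := mem_codeAtoms.1 h
      rw [length_bitsOf] at hi
      have := h₃ i hi h₁
      cases (bitsOf L j)[i]
      · simpa [Nat.add_comm] using this.1
      · have e : 1 + 2 * i + true.toNat = 2 * i + 2 := by simp; omega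
        rw [e]; exact this.2
  -- Minimality would give `I ⊆ J` and hence `0 ∈ J`.
  refine h0 (hmin (hasModel_reduct_cnfProgram.2
    ⟨h₁, fun i hi => ?_, fun i _ h => absurd h h0, fun i hi l hl hlit hc => ?_,
      fun i hi hi' hc => ?_⟩) hJI h₁)
  · rcases lt_or_ge i L with h | h
    · have : 1 + 2 * i + ((bitsOf L j)[i]'(by simpa using h)).toNat ∈ J :=
        (hJ _).2 (.inr (mem_codeAtoms.2 ⟨i, by simpa using h, rfl⟩))
      cases hb : (bitsOf L j)[i]'(by simpa using h)
      · rw [hb] at this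
        left; simpa [Nat.add_comm] using this
      · rw [hb] at this
        right
        have e : 1 + 2 * i + true.toNat = 2 * i + 2 := by simp; omega
        rwa [e] at this
    · rcases h₂ i hi with h' | h'
      · exact .inl ((hJ _).2 (.inl ⟨h', by omega⟩))
      · exact .inr ((hJ _).2 (.inl ⟨h', by omega⟩))
  · obtain rfl := hcodeJ i (by omega) hc
    have := hno l hl
    rcases l with ⟨v, _ | _⟩
    · simp at hlit this
      exact absurd this hlit
    · simp at hlit this
      exact absurd (hJI hlit) this
  · have := hcodeJ i hi' hc
    omega

/-- The answer set has `0`, all bit atoms, and the atom of the right value for each variable. A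
model `J ⊆ I` of the reduct chooses a code; a true literal of that clause, or the rule for an unused
code, yields `0`, and saturation yields all bits. The variable atoms lie in `J` because `I` has only
one of each pair. -/
theorem consistent_of_satisfiable {L B : ℕ} {cs : List (List Literal)}
    (hB : ∀ c ∈ cs, ∀ l ∈ c, l.1 < B) {τ : ℕ → Bool} (h : ∀ c ∈ cs, ∃ l ∈ c, τ l.1 = l.2) :
    (cnfProgram L B cs).Consistent := by
  classical
  set I : Finset ℕ := (Finset.range (2 * (L + B) + 1)).filter fun a =>
    a ≤ 2 * L ∨ ∃ v, a = 2 * (L + v) + 1 ∧ τ v = true ∨ a = 2 * (L + v) + 2 ∧ τ v = false with hIdef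
  have hI : ∀ a, a ∈ I ↔ a < 2 * (L + B) + 1 ∧ (a ≤ 2 * L ∨
      ∃ v, a = 2 * (L + v) + 1 ∧ τ v = true ∨ a = 2 * (L + v) + 2 ∧ τ v = false) := by
    simp [hIdef]
  have h0 : 0 ∈ I := (hI 0).2 ⟨by omega, .inl (by omega)⟩
  have htop : ∀ i < L, 2 * i + 1 ∈ I ∧ 2 * i + 2 ∈ I := fun i hi =>
    ⟨(hI _).2 ⟨by omega, .inl (by omega)⟩, (hI _).2 ⟨by omega, .inl (by omega)⟩⟩
  have hx : ∀ v < B, (2 * (L + v) + 1 ∈ I ↔ τ v = true) ∧ (2 * (L + v) + 2 ∈ I ↔ τ v = false) := by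
    intro v hv
    rw [hI, hI]
    constructor
    · constructor
      · rintro ⟨-, h | ⟨u, ⟨e, hu⟩ | ⟨e, hu⟩⟩⟩
        · omega
        · obtain rfl : v = u := by omega
          exact hu
        · omega
      · exact fun h => ⟨by omega, .inr ⟨v, .inl ⟨rfl, h⟩⟩⟩
    · constructor
      · rintro ⟨-, h | ⟨u, ⟨e, hu⟩ | ⟨e, hu⟩⟩⟩
        · omega
        · omega
        · obtain rfl : v = u := by omega
          exact hu
      · exact fun h => ⟨by omega, .inr ⟨v, .inr ⟨rfl, h⟩⟩⟩
  refine ⟨I, hasModel_reduct_cnfProgram.2 ⟨h0, fun i hi => ?_, fun i hi _ => htop i hi,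
    fun _ _ _ _ _ _ => h0, fun _ _ _ _ => h0⟩, fun J hJ hJI => ?_⟩
  · rcases lt_or_ge i L with h' | h'
    · exact .inl (htop i h').1
    · obtain ⟨v, rfl⟩ := Nat.exists_eq_add_of_le h'
      have := hx v (by omega)
      cases hv : τ v
      · exact .inr (this.2.2 hv)
      · exact .inl (this.1.2 hv)
  · obtain ⟨-, h₂, h₃, h₄, h₅⟩ := hasModel_reduct_cnfProgram.1 hJ
    have h0J : 0 ∈ J := by
      -- `J` may contain both atoms of a bit; then the value zero is chosen.
      set b : List Bool := (List.range L).map fun i => decide (2 * i + 1 ∉ J) with hb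
      obtain ⟨j, hj, e⟩ := exists_bitsOf b
      have hlen : b.length = L := by simp [hb]
      rw [hlen] at hj e
      have hcode : ∀ a ∈ codeAtoms 1 (bitsOf L j), a ∈ J := by
        intro a ha
        obtain ⟨i, hi, rfl⟩ := mem_codeAtoms.1 ha
        rw [length_bitsOf] at hi
        have : (bitsOf L j)[i]'(by simpa using hi) = decide (2 * i + 1 ∉ J) := by simp [e, hb]
        rw [this]
        by_cases hi' : 2 * i + 1 ∈ J
        · have e₁ : decide (2 * i + 1 ∉ J) = false := by simpa using hi'
          have e₂ : 1 + 2 * i + false.toNat = 2 * i + 1 := by simp; omega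
          rwa [e₁, e₂]
        · have := (h₂ i (by omega)).resolve_left hi'
          have e : 1 + 2 * i + 1 = 2 * i + 2 := by omega
          simpa [hi', e] using this
      rcases lt_or_ge j cs.length with hjc | hjc
      · obtain ⟨l, hl, hτ⟩ := h _ (List.getElem_mem hjc)
        refine h₄ j hjc l hl ?_ hcode
        have hlB := hB _ (List.getElem_mem hjc) l hl
        have := hx l.1 hlB
        rcases l with ⟨v, _ | _⟩
        · simp at hτ this ⊢
          rw [this.1, hτ]; simp
        · simp at hτ hlB this ⊢
          refine (h₂ (L + v) (by omega)).resolve_right fun h' => ?_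
          have := this.2.1 (hJI h')
          rw [hτ] at this
          simp at this
      · exact h₅ j hjc hj hcode
    intro a ha
    obtain ⟨haB, h' | ⟨v, ⟨rfl, hv⟩ | ⟨rfl, hv⟩⟩⟩ := (hI a).1 ha
    · rcases Nat.eq_zero_or_pos a with rfl | hpos
      · exact h0J
      · have := h₃ ((a - 1) / 2) (by omega) h0J
        rcases (by omega : a = 2 * ((a - 1) / 2) + 1 ∨ a = 2 * ((a - 1) / 2) + 2) with e | e
        · rw [e]; exact this.1
        · rw [e]; exact this.2
    · refine (h₂ (L + v) (by omega)).resolve_right fun h' => ?_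
      have := (hx v (by omega)).2.1 (hJI h')
      rw [hv] at this
      simp at this
    · refine (h₂ (L + v) (by omega)).resolve_left fun h' => ?_
      have := (hx v (by omega)).1.1 (hJI h')
      rw [hv] at this
      simp at this

/-! ### Treedepth of the incidence graph -/

/-- A Trémaux tree that is given by a parent function bounds the treedepth. -/
theorem treedepth_le_of_parent {V : Type} (G : SimpleGraph V) (parent : V → V) (rank : V → ℕ)
    (root : V) (hroot : parent root = root) (hrank : ∀ v, v ≠ root → rank (parent v) < rank v)
    (h : ℕ) (hh : ∀ v, rank v ≤ h)
    (hG : ∀ u v, G.Adj u v → (∃ n, parent^[n] v = u) ∨ ∃ n, parent^[n] u = v) :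
    treedepth G ≤ h := by
  classical
  -- Ancestors other than the vertex itself have smaller rank, which excludes cycles and yields
  -- antisymmetry.
  have hiter : ∀ n v, parent^[n] v = v ∨ rank (parent^[n] v) < rank v := by
    intro n
    induction n with
    | zero => exact fun v => .inl rfl
    | succ n ih =>
      intro v
      rw [Function.iterate_succ_apply]
      by_cases hv : v = root
      · subst hv; rw [hroot]; exact ih v
      · right
        have h₁ := hrank v hv
        rcases ih (parent v) with h₂ | h₂
        · rwa [h₂]
        · omega
  have hbot : ∀ k v, rank v ≤ k → ∃ n, parent^[n] v = root := by
    intro k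
    induction k with
    | zero =>
      intro v hv
      by_contra hne
      have := hrank v fun e => hne ⟨0, e⟩
      omega
    | succ k ih =>
      intro v hv
      by_cases hvr : v = root
      · exact ⟨0, hvr⟩
      · obtain ⟨n, hn⟩ := ih (parent v) (by have := hrank v hvr; omega)
        exact ⟨n + 1, hn⟩
  let po : PartialOrder V :=
    { le := fun x y => ∃ n, parent^[n] y = x
      le_refl := fun x => ⟨0, rfl⟩
      le_trans := by
        rintro x y z ⟨m, rfl⟩ ⟨n, rfl⟩
        exact ⟨m + n, Function.iterate_add_apply ..⟩
      le_antisymm := by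
        rintro x y ⟨m, hm⟩ ⟨n, hn⟩
        rcases hiter m y with h₁ | h₁
        · exact hm.symm.trans h₁
        · rcases hiter n x with h₂ | h₂
          · exact h₂.symm.trans hn
          · rw [hm] at h₁; rw [hn] at h₂; omega }
  -- The infimum of `x` and `y` is the first ancestor of `x` that is also one of `y`; the root shows
  -- that there is one.
  have hex : ∀ x y : V, ∃ n, parent^[n] x ≤ y := fun x y => by
    obtain ⟨n, hn⟩ := hbot _ x le_rfl
    obtain ⟨m, hm⟩ := hbot _ y le_rfl
    exact ⟨n, m, hm.trans hn.symm⟩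
  let sl : SemilatticeInf V :=
    { po with
      inf := fun x y => parent^[Nat.find (hex x y)] x
      inf_le_left := fun x y => ⟨_, rfl⟩
      inf_le_right := fun x y => Nat.find_spec (hex x y)
      le_inf := by
        rintro z x y ⟨m, rfl⟩ hy
        have hle := Nat.find_min' (hex x y) hy
        refine ⟨m - Nat.find (hex x y), ?_⟩
        rw [← Function.iterate_add_apply, Nat.sub_add_cancel hle] }
  let ob : OrderBot V := { bot := root, bot_le := fun v => hbot _ v le_rfl }
  have hlt : ∀ {x y : V}, x < y → ∃ n, parent^[n] (parent y) = x := by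
    rintro x y hxy
    obtain ⟨n, hn⟩ := hxy.le
    cases n with
    | zero => exact absurd hn.symm hxy.ne
    | succ n => exact ⟨n, hn⟩
  let pr : PredOrder V :=
    { pred := parent
      pred_le := fun v => ⟨1, rfl⟩
      min_of_le_pred := by
        rintro v ⟨n, hn⟩
        by_cases hv : v = root
        · subst hv; exact isMin_bot
        · have h₁ := hrank v hv
          rcases hiter n (parent v) with h₂ | h₂ <;> rw [hn] at h₂
          · rw [← h₂] at h₁; omega
          · omega
      le_pred_of_lt := fun hxy => hlt hxy }
  have ar : IsPredArchimedean V := ⟨fun {_ _} hab => hab⟩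
  have hmono : StrictMono rank := fun x y hxy => by
    obtain ⟨n, hn⟩ := hxy.le
    rcases hiter n y with h₁ | h₁
    · exact absurd (hn.symm.trans h₁) hxy.ne
    · rwa [hn] at h₁
  refine Nat.sInf_le ⟨⟨V⟩, Equiv.refl V, fun u v huv => hG u v huv, fun x => ?_⟩
  have := Order.height_le_height_apply_of_strictMono rank hmono x
  rw [Order.height_nat] at this
  exact this.trans (by exact_mod_cast hh x)

/-- The parent of an atom in a Trémaux tree of the program of a formula. -/
def parentAtom (L a : ℕ) : ℕ := if a ≤ 2 * L ∨ a % 2 = 0 then a - 1 else 2 * L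

theorem parentAtom_le (L a : ℕ) : parentAtom L a ≤ a := by
  unfold parentAtom; split_ifs <;> omega

theorem exists_iterate_parentAtom_of_le {L a b : ℕ} (h : a ≤ b) (hb : b ≤ 2 * L) :
    ∃ n, (parentAtom L)^[n] b = a := by
  induction b with
  | zero => exact ⟨0, by simpa using (Nat.le_zero.1 h).symm⟩
  | succ b ih =>
    rcases Nat.lt_or_eq_of_le h with h | rfl
    · obtain ⟨n, hn⟩ := ih (by omega) (by omega)
      refine ⟨n + 1, ?_⟩
      rw [Function.iterate_succ_apply]
      simpa [parentAtom, hb] using hn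
    · exact ⟨0, rfl⟩

/-- The atoms `0, …, 2 * L` form a path from the root, and each variable hangs its two atoms below
`2 * L`, one under the other. -/
theorem exists_iterate_parentAtom {L i a : ℕ} (hi : L ≤ i)
    (ha : a ≤ 2 * L ∨ a = 2 * i + 1 ∨ a = 2 * i + 2) :
    ∃ n, (parentAtom L)^[n] (2 * i + 2) = a := by
  have h₁ : parentAtom L (2 * i + 2) = 2 * i + 1 := by
    rw [parentAtom, if_pos (by omega)]; omega
  have h₂ : parentAtom L (2 * i + 1) = 2 * L := by
    rw [parentAtom, if_neg (by omega)]
  rcases ha with ha | rfl | rfl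
  · obtain ⟨n, hn⟩ := exists_iterate_parentAtom_of_le ha le_rfl
    refine ⟨n + 2, ?_⟩
    rw [Function.iterate_add_apply]
    simp [h₁, h₂, hn]
  · exact ⟨1, h₁⟩
  · exact ⟨0, rfl⟩

/-- No rule mentions two variables, so its atoms lie on one branch, and the rule can be attached as
a leaf. -/
theorem exists_parent_rule {L B : ℕ} {cs : List (List Literal)} (hB : ∀ c ∈ cs, ∀ l ∈ c, l.1 < B)
    {r : Rule} (hr : r ∈ cnfProgram L B cs) :
    ∃ p < 2 * (L + B) + 1, ∀ a ∈ r.atoms, ∃ n, (parentAtom L)^[n] p = a := by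
  have htop : (∀ a ∈ r.atoms, a ≤ 2 * L) →
      ∃ p < 2 * (L + B) + 1, ∀ a ∈ r.atoms, ∃ n, (parentAtom L)^[n] p = a := fun h =>
    ⟨2 * L, by omega, fun a ha => exists_iterate_parentAtom_of_le (h a ha) le_rfl⟩
  have hcode : ∀ {a j}, a ∈ codeAtoms 1 (bitsOf L j) → a ≤ 2 * L := fun {a j} h => by
    have := bounds_of_mem_codeAtoms h
    rw [length_bitsOf] at this
    omega
  obtain ⟨k, hk, rfl⟩ := mem_cnfProgram.1 hr
  simp only [Key.mem_atoms_toRule] at htop ⊢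
  rcases mem_allKeys.1 hk with rfl | ⟨i, hi, rfl⟩ | ⟨i, hi, rfl | rfl⟩ | ⟨j, hj, l, hl, rfl⟩ |
    ⟨j, -, -, rfl⟩
  · refine htop fun a ha => ?_
    simp [Key.head, Key.pos, Key.neg] at ha
    omega
  · rcases lt_or_ge i L with h | h
    · refine htop fun a ha => ?_
      simp [Key.head, Key.pos, Key.neg] at ha
      omega
    · refine ⟨2 * i + 2, by omega, fun a ha => exists_iterate_parentAtom h ?_⟩
      simp [Key.head, Key.pos, Key.neg] at ha
      omega
  · refine htop fun a ha => ?_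
    simp [Key.head, Key.pos, Key.neg] at ha
    omega
  · refine htop fun a ha => ?_
    simp [Key.head, Key.pos, Key.neg] at ha
    omega
  · have h := hB _ (List.getElem_mem hj) l hl
    refine ⟨2 * (L + l.1) + 2, by omega, fun a ha => exists_iterate_parentAtom (by omega) ?_⟩
    rcases l with ⟨v, _ | _⟩ <;> simp [Key.head, Key.pos, Key.neg] at ha ⊢
    · rcases ha with ha | ha | ha
      · omega
      · exact .inl (hcode ha)
      · omega
    · rcases ha with ha | ha | ha
      · omega
      · exact .inl (hcode ha)
      · omega
  · refine htop fun a ha => ?_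
    simp [Key.head, Key.pos, Key.neg] at ha
    rcases ha with ha | ha
    · omega
    · exact hcode ha

theorem treedepth_cnfProgram_le {L B : ℕ} {cs : List (List Literal)}
    (hB : ∀ c ∈ cs, ∀ l ∈ c, l.1 < B) :
    treedepth (cnfProgram L B cs).incidenceGraph ≤ 2 * L + 3 := by
  have hatoms := atoms_cnfProgram (L := L) hB
  have hmem : ∀ {a}, a ∈ (cnfProgram L B cs).atoms ↔ a < 2 * (L + B) + 1 := fun {a} => by
    rw [hatoms, Finset.mem_range]
  choose! p hp hpa using fun r (hr : r ∈ cnfProgram L B cs) => exists_parent_rule hB hr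
  let parent : {a // a ∈ (cnfProgram L B cs).atoms} ⊕ {r // r ∈ cnfProgram L B cs} →
      {a // a ∈ (cnfProgram L B cs).atoms} ⊕ {r // r ∈ cnfProgram L B cs}
    | .inl a => .inl ⟨parentAtom L a.1, hmem.2 ((parentAtom_le L a.1).trans_lt (hmem.1 a.2))⟩
    | .inr r => .inl ⟨p r.1, hmem.2 (hp r.1 r.2)⟩
  -- Not always the depth: a rule gets `2 * L + 3` even if it hangs directly below the trunk.
  let rank : {a // a ∈ (cnfProgram L B cs).atoms} ⊕ {r // r ∈ cnfProgram L B cs} → ℕ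
    | .inl a => if a.1 ≤ 2 * L then a.1 else if a.1 % 2 = 0 then 2 * L + 2 else 2 * L + 1
    | .inr _ => 2 * L + 3
  have hparent : ∀ (n : ℕ) (a : ℕ) (ha : a ∈ (cnfProgram L B cs).atoms) (b : ℕ)
      (hb : b ∈ (cnfProgram L B cs).atoms), (parentAtom L)^[n] b = a →
      parent^[n] (.inl ⟨b, hb⟩) = .inl ⟨a, ha⟩ := by
    intro n a ha
    induction n with
    | zero => rintro b hb rfl; rfl
    | succ n ih =>
      intro b hb h
      exact ih _ _ h
  have hedge : ∀ (a : ℕ) (ha : a ∈ (cnfProgram L B cs).atoms) (r : Rule)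
      (hr : r ∈ cnfProgram L B cs), a ∈ r.atoms → ∃ n, parent^[n] (.inr ⟨r, hr⟩) = .inl ⟨a, ha⟩ := by
    intro a ha r hr har
    obtain ⟨n, hn⟩ := hpa r hr a har
    exact ⟨n + 1, hparent n a ha _ _ hn⟩
  refine treedepth_le_of_parent _ parent rank (.inl ⟨0, hmem.2 (by omega)⟩) ?_ ?_ _ ?_ ?_
  · simp [parent, parentAtom]
  · rintro (⟨a, ha⟩ | ⟨r, hr⟩) hne
    · have h0 : a ≠ 0 := fun h => hne (by subst h; rfl)
      simp only [parent, rank, parentAtom]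
      split_ifs <;> omega
    · simp only [parent, rank]
      split_ifs <;> omega
  · rintro (⟨a, ha⟩ | ⟨r, hr⟩)
    · simp only [rank]
      split_ifs <;> omega
    · exact le_rfl
  · rintro (⟨a, ha⟩ | ⟨r, hr⟩) (⟨b, hb⟩ | ⟨s, hs⟩) h
    · exact h.elim
    · exact .inl (hedge a ha s hs h)
    · exact .inr (hedge b hb r hr h)
    · exact h.elim

/-! ### Running time of the reduction -/

instance : Inhabited CNFSymbol := ⟨.tick⟩

instance : Fintype CNFSymbol where
  elems := {.tick, .pos, .neg, .bar}
  complete a := by cases a <;> decide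

/-- A step pushes at most one symbol, so the running time bounds the output. -/
theorem Cmd.Exec.length_le {K A : Type} [DecidableEq K] {c : Cmd K A} {s s' : K → List A} {t : ℕ}
    (h : c.Exec s s' t) (k : K) : (s' k).length ≤ (s k).length + t := by
  induction h with
  | skip s => omega
  | push k' a s =>
    by_cases hk : k = k'
    · subst hk; simp
    · simp [hk]
  | seq _ _ ih₁ ih₂ => omega
  | @case k' f s s' t _ ih =>
    refine ih.trans ?_
    by_cases hk : k = k'
    · subst hk; simp; omega
    · simp [hk]
  | loop_nil _ => omega
  | @loop_cons k' f s s' s'' a l t t' hs _ _ ih₁ ih₂ =>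
    have : (Function.update s k' l k).length ≤ (s k).length := by
      by_cases hk : k = k'
      · subst hk; simp [hs]
      · simp [hk]
    omega

/-- A representation of a formula lists the literals of the clauses. -/
theorem exists_clauses_of_encoded {F : CNF} {w : List CNFSymbol} (h : F.EncodedAs3CNF w) :
    ∃ cs : List (List Literal), w = clausesWord cs ∧ cs.length = F.card ∧
      (∀ c ∈ cs, c.Nodup ∧ c.toFinset ∈ F) ∧ ∀ c ∈ F, ∃ l ∈ cs, l.toFinset = c := by
  obtain ⟨-, -, fs, ws, hfs, hws, rfl⟩ := h
  have key : ∀ {fs ws}, List.Forall₂ ClauseEncodedBy fs ws → ∃ cs : List (List Literal),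
      ws.flatten = clausesWord cs ∧ List.Forall₂ (fun f (c : List Literal) => ↑c = f.val) fs cs := by
    intro fs ws hws
    induction hws with
    | nil => exact ⟨[], rfl, .nil⟩
    | @cons f w fs ws hw _ ih =>
      obtain ⟨cs, hcs, hcs'⟩ := ih
      obtain ⟨l, hl, rfl⟩ := hw
      exact ⟨l :: cs, by simp [hcs, clausesWord], .cons hl hcs'⟩
  have hfin : ∀ {f : Finset Literal} {c : List Literal}, (c : Multiset Literal) = f.val →
      c.Nodup ∧ c.toFinset = f := by
    intro f c e
    have hn : c.Nodup := by
      have := f.nodup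
      rwa [← e, Multiset.coe_nodup] at this
    refine ⟨hn, Finset.ext fun x => ?_⟩
    rw [List.mem_toFinset, ← Multiset.mem_coe, e, Finset.mem_val]
  have hF : ∀ f, f ∈ F ↔ f ∈ fs := fun f => by rw [← Finset.mem_val, ← hfs, Multiset.mem_coe]
  obtain ⟨cs, hcs, hcs'⟩ := key hws
  refine ⟨cs, hcs, ?_, fun c hc => ?_, fun f hf => ?_⟩
  · rw [← hcs'.length_eq, Finset.card_def, ← hfs, Multiset.coe_card]
  · obtain ⟨i, hi, rfl⟩ := List.mem_iff_getElem.1 hc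
    have h := hfin (List.forall₂_iff_get.1 hcs' |>.2 i (hcs'.length_eq ▸ hi) hi)
    exact ⟨h.1, by rw [List.get_eq_getElem] at h; rw [h.2, hF]; exact List.get_mem _ _⟩
  · obtain ⟨i, hi, rfl⟩ := List.mem_iff_getElem.1 ((hF f).1 hf)
    have h := hfin (List.forall₂_iff_get.1 hcs' |>.2 i hi (hcs'.length_eq ▸ hi))
    exact ⟨_, List.get_mem _ _, h.2⟩

/-! ### The size of a formula in terms of its number of variables -/

theorem length_literalsWord_le {l : List Literal} {n : ℕ} (h : ∀ x ∈ l, x.1 < n) :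
    (literalsWord l).length ≤ l.length * n := by
  induction l with
  | nil => simp [literalsWord]
  | cons x l ih =>
    have h₁ := ih fun x hx => h x (by simp [hx])
    have h₂ := h x (by simp)
    simp only [literalsWord, List.flatMap_cons, List.length_append, List.length_replicate,
      List.length_cons, List.length_nil] at h₁ ⊢
    rw [Nat.add_mul]
    omega

theorem length_clausesWord_le {cs : List (List Literal)} {n : ℕ}
    (h : ∀ c ∈ cs, c.length ≤ 3 ∧ ∀ x ∈ c, x.1 < n) :
    (clausesWord cs).length ≤ cs.length * (3 * n + 1) := by
  induction cs with
  | nil => simp [clausesWord]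
  | cons c cs ih =>
    have h₁ := ih fun c hc => h c (by simp [hc])
    have h₂ := h c (by simp)
    have h₃ := length_literalsWord_le h₂.2
    have h₄ := Nat.mul_le_mul_right n h₂.1
    simp only [clausesWord, List.flatMap_cons, List.length_append, List.length_cons,
      List.length_nil] at h₁ ⊢
    rw [Nat.add_mul]
    omega

/-- Unary numbers make the input longer than any variable number, so `B` guessed variables suffice.
-/
theorem lt_length_clausesWord {cs : List (List Literal)} {c : List Literal} (hc : c ∈ cs)
    {l : Literal} (hl : l ∈ c) : l.1 < (clausesWord cs).length := by
  have h₁ : l.1 < (literalsWord c).length := by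
    obtain ⟨c₁, c₂, rfl⟩ := List.append_of_mem hl
    simp [literalsWord]
    omega
  obtain ⟨c₁, c₂, rfl⟩ := List.append_of_mem hc
  simp [clausesWord] at h₁ ⊢
  omega

/-- There are four possible clause sizes, with at most `(2 * n + 1) ^ 3` clauses each. No
sparsification is needed, since only the logarithm of this number enters the treedepth. -/
theorem DisjASP.CNF.card_le {F : CNF} {n : ℕ} (h₃ : F.Is3CNF) (hn : F.vars = Finset.range n) :
    F.card ≤ 4 * (2 * n + 1) ^ 3 := by
  have hsub : F ⊆ (Finset.range 4).biUnion
      fun i => Finset.powersetCard i (Finset.range n ×ˢ (Finset.univ : Finset Bool)) := by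
    intro c hc
    rw [Finset.mem_biUnion]
    refine ⟨c.card, Finset.mem_range.2 (by have := h₃ c hc; omega),
      Finset.mem_powersetCard.2 ⟨fun x hx => ?_, rfl⟩⟩
    rw [Finset.mem_product, ← hn]
    exact ⟨Finset.mem_biUnion.2 ⟨c, hc, Finset.mem_image_of_mem _ hx⟩, Finset.mem_univ _⟩
  refine (Finset.card_le_card hsub).trans ((Finset.card_biUnion_le_card_mul _ _
    ((2 * n + 1) ^ 3) fun i hi => ?_).trans (by simp))
  rw [Finset.card_powersetCard, Finset.card_product, Finset.card_range, Finset.card_univ,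
    Fintype.card_bool]
  refine (Nat.choose_le_pow _ _).trans ?_
  calc (n * 2) ^ i ≤ (2 * n + 1) ^ i := Nat.pow_le_pow_left (by omega) i
    _ ≤ (2 * n + 1) ^ 3 := Nat.pow_le_pow_right (by omega) (by have := Finset.mem_range.1 hi; omega)

/-! ### The exponent of the running time -/

theorem exists_bound_of_isLittleO {f : ℕ → ℝ}
    (hf : f =o[Filter.atTop] (fun k : ℕ => (k : ℝ))) {ε : ℝ} (hε : 0 < ε) :
    ∃ C : ℝ, ∀ k, f k ≤ ε * k + C := by
  obtain ⟨N, hN⟩ := Filter.eventually_atTop.1 (hf.def hε)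
  -- The sum absorbs the finitely many `k` for which the asymptotic bound may fail.
  refine ⟨∑ k ∈ Finset.range N, |f k|, fun k => ?_⟩
  have hs : 0 ≤ ∑ k ∈ Finset.range N, |f k| := Finset.sum_nonneg fun _ _ => abs_nonneg _
  rcases lt_or_ge k N with hk | hk
  · have h₁ := Finset.single_le_sum (f := fun k => |f k|) (fun i _ => abs_nonneg _)
      (Finset.mem_range.2 hk)
    have h₂ : 0 ≤ ε * k := by positivity
    linarith [le_abs_self (f k)]
  · have := hN k hk
    rw [Real.norm_eq_abs, Real.norm_natCast] at this
    linarith [le_abs_self (f k)]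

/-- If the treedepth is logarithmic in `n`, then the exponent of the running time is smaller than any
linear function of `n`. -/
theorem exists_exponent_bound {f : ℕ → ℝ} (hf : f =o[Filter.atTop] (fun k : ℕ => (k : ℝ)))
    {δ : ℝ} (hδ : 0 < δ) :
    ∃ D : ℝ, ∀ n L k : ℕ, 2 ^ L ≤ 9 * (3 * n + 1) ^ 4 → k ≤ 2 * L + 3 →
      (2 : ℝ) ^ f k ≤ δ * n + D := by
  -- With `k ≤ 2 * L + 3` this leaves the exponent `L / 8`, and the eighth root of `(3 * n + 1) ^ 4`
  -- is `√(3 * n + 1)`.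
  obtain ⟨C, hC⟩ := exists_bound_of_isLittleO hf (ε := 1 / 16) (by norm_num)
  set K : ℝ := (2 : ℝ) ^ (C + 3 / 16) * (9 : ℝ) ^ (1 / 8 : ℝ) with hK
  refine ⟨δ / 3 + 3 * K ^ 2 / (4 * δ), fun n L k hL hk => ?_⟩
  set s : ℝ := Real.sqrt (3 * n + 1) with hs
  have hs2 : s ^ 2 = 3 * n + 1 := Real.sq_sqrt (by positivity)
  have h₁ : (2 : ℝ) ^ f k ≤ K * s := by
    have hk' : (k : ℝ) ≤ 2 * L + 3 := by exact_mod_cast hk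
    have hL' : (2 : ℝ) ^ (L : ℝ) ≤ 9 * (3 * n + 1) ^ 4 := by
      rw [Real.rpow_natCast]; exact_mod_cast hL
    have e₁ : ((3 * n + 1 : ℝ) ^ 4) ^ (1 / 8 : ℝ) = s := by
      rw [hs, Real.sqrt_eq_rpow, ← Real.rpow_natCast, ← Real.rpow_mul (by positivity)]
      norm_num
    calc (2 : ℝ) ^ f k ≤ (2 : ℝ) ^ ((C + 3 / 16) + (L : ℝ) * (1 / 8)) :=
          Real.rpow_le_rpow_of_exponent_le (by norm_num) (by linarith [hC k])
      _ = (2 : ℝ) ^ (C + 3 / 16) * ((2 : ℝ) ^ (L : ℝ)) ^ (1 / 8 : ℝ) := by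
          rw [Real.rpow_add (by norm_num), Real.rpow_mul (by norm_num)]
      _ ≤ (2 : ℝ) ^ (C + 3 / 16) * (9 * (3 * n + 1 : ℝ) ^ 4) ^ (1 / 8 : ℝ) := by
          gcongr
      _ = K * s := by
          rw [Real.mul_rpow (by norm_num) (by positivity), e₁, hK, mul_assoc]
  -- Completing the square; as `s ^ 2 = 3 * n + 1`, the coefficient `δ / 3` yields `δ * n + δ / 3`.
  have h₂ : K * s ≤ δ / 3 * s ^ 2 + 3 * K ^ 2 / (4 * δ) := by
    have h₃ : δ / 3 * s ^ 2 + 3 * K ^ 2 / (4 * δ) - K * s =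
        (2 * δ * s - 3 * K) ^ 2 / (12 * δ) := by
      field_simp
      ring
    have h₄ : 0 ≤ (2 * δ * s - 3 * K) ^ 2 / (12 * δ) := by positivity
    linarith
  rw [hs2] at h₂
  linarith

theorem Polynomial.eval_mono_nat (p : Polynomial ℕ) {m n : ℕ} (h : m ≤ n) :
    p.eval m ≤ p.eval n := by
  rw [Polynomial.eval_eq_sum, Polynomial.eval_eq_sum]
  exact Finset.sum_le_sum fun i _ => Nat.mul_le_mul_left _ (Nat.pow_le_pow_left h i)

theorem get_init (w : List CNFSymbol) :
    (⟨w, [], [], [], [], [], [], [], []⟩ : St).get = Function.update (fun _ => []) .inp w := by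
  funext k
  cases k <;> simp [St.get]

theorem get_final (o : List CNFSymbol) :
    (⟨[], o, [], [], [], [], [], [], []⟩ : St).get =
      Function.update (fun _ => []) .out o.reverse := by
  funext k
  cases k <;> simp [St.get]

/-- The translation of a formula with `n` variables: an equivalent program whose treedepth is
logarithmic in `n`. -/
theorem exists_translation {F : CNF} {w : List CNFSymbol} (h : F.EncodedAs3CNF w) :
    ∃ (P : Program) (u : List CNFSymbol) (t L : ℕ),
      translateCNF.Exec (Function.update (fun _ => []) .inp w)
        (Function.update (fun _ => []) .out u) t ∧
      P.EncodedBy (u.map toProgramSymbol).reverse ∧ (F.Satisfiable ↔ P.Consistent) ∧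
      t ≤ 20000 * (w.length + 2) ^ 3 ∧ u.length ≤ t ∧ P.atoms.card ≤ 6 * w.length + 3 ∧
      treedepth P.incidenceGraph ≤ 2 * L + 3 ∧ 2 ^ L ≤ 9 * (3 * F.vars.card + 1) ^ 4 := by
  obtain ⟨cs, rfl, hcard, hcs, hF⟩ := exists_clauses_of_encoded h
  obtain ⟨h3, hvars, -⟩ := h
  obtain ⟨L, h₁, h₂, t, ht, hexec⟩ := runs_translateCNF cs rfl
  rw [get_init, get_final] at hexec
  have hB : ∀ c ∈ cs, ∀ l ∈ c, l.1 < (clausesWord cs).length :=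
    fun c hc l hl => lt_length_clausesWord hc hl
  have hlen := length_le_length_clausesWord cs
  have hL : L < 2 * (clausesWord cs).length + 1 := lt_of_lt_of_le Nat.lt_two_pow_self h₂
  refine ⟨cnfProgram L (clausesWord cs).length cs, _, t, L, hexec, ?_, ⟨?_, ?_⟩, ht, ?_, ?_,
    treedepth_cnfProgram_le hB, ?_⟩
  · rw [List.map_reverse, List.reverse_reverse]
    exact cnfProgram_encodedBy (fun c hc => (hcs c hc).1) (by omega) hB
  · rintro ⟨τ, hτ⟩
    refine consistent_of_satisfiable hB (τ := τ) fun c hc => ?_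
    obtain ⟨l, hl, e⟩ := hτ _ (hcs c hc).2
    exact ⟨l, List.mem_toFinset.1 hl, e⟩
  · intro hP
    obtain ⟨τ, hτ⟩ := satisfiable_of_consistent (by omega) hP
    refine ⟨τ, fun c hc => ?_⟩
    obtain ⟨l, hl, rfl⟩ := hF c hc
    obtain ⟨x, hx, e⟩ := hτ l hl
    exact ⟨x, List.mem_toFinset.2 hx, e⟩
  · simpa using hexec.length_le .out
  · rw [atoms_cnfProgram hB, Finset.card_range]
    omega
  · set n := F.vars.card
    have hw : (clausesWord cs).length ≤ F.card * (3 * n + 1) := by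
      rw [← hcard]
      refine length_clausesWord_le fun c hc => ⟨?_, fun x hx => ?_⟩
      · rw [← List.toFinset_card_of_nodup (hcs c hc).1]
        exact h3 _ (hcs c hc).2
      · rw [← Finset.mem_range, ← hvars]
        exact Finset.mem_biUnion.2
          ⟨_, (hcs c hc).2, Finset.mem_image_of_mem _ (List.mem_toFinset.2 hx)⟩
    have h₅ : F.card * (3 * n + 1) ≤ 4 * (3 * n + 1) ^ 4 := by
      calc F.card * (3 * n + 1) ≤ 4 * (2 * n + 1) ^ 3 * (3 * n + 1) :=
            Nat.mul_le_mul_right _ (CNF.card_le h3 hvars)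
        _ ≤ 4 * (3 * n + 1) ^ 3 * (3 * n + 1) := by gcongr; omega
        _ = 4 * (3 * n + 1) ^ 4 := by ring
    -- The factor `9` comes from `2 ^ L ≤ 2 * B + 1` and `B ≤ 4 * (3 * n + 1) ^ 4`.
    have h₆ : 1 ≤ (3 * n + 1) ^ 4 := Nat.one_le_pow _ _ (by omega)
    omega

theorem mainTheorem4 (hETH : DisjASP.ETH) :
    ¬ ∃ (f : ℕ → ℝ) (p : Polynomial ℕ),
      f =o[Filter.atTop] (fun k : ℕ => (k : ℝ)) ∧
      DisjASP.SolvableInTime DisjASP.Program.EncodedBy DisjASP.Program.Consistent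
        (fun P _ => (2 : ℝ) ^ ((2 : ℝ) ^ f (DisjASP.treedepth P.incidenceGraph)) *
          (p.eval P.atoms.card : ℕ)) := by
  rintro ⟨f, p, hf, hsolv⟩
  obtain ⟨δ, hδ, hno⟩ := hETH
  obtain ⟨D, hD⟩ := exists_exponent_bound hf hδ
  obtain ⟨N, hN⟩ := exists_nat_ge ((2 : ℝ) ^ D)
  -- The first summands pay for the translation and the move of its output, at most `2 * t + 1`
  -- steps. The last one pays for the given machine, with `N` in place of the factor `2 ^ D`.
  refine hno ⟨40000 * (.X + 2) ^ 3 + 1 + .C N * p.comp (6 * .X + 3),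
    hsolv.of_exec translateCNF .inp .out toProgramSymbol fun F w hw => ?_⟩
  obtain ⟨P, u, t, L, hexec, henc, hiff, ht, hu, hcard, htd, hL⟩ := exists_translation hw
  refine ⟨P, u, t, hexec, henc, hiff, ?_⟩
  have h₁ : (2 : ℝ) ^ ((2 : ℝ) ^ f (treedepth P.incidenceGraph)) ≤
      (2 : ℝ) ^ (δ * (F.vars.card : ℝ)) * N := by
    calc (2 : ℝ) ^ ((2 : ℝ) ^ f (treedepth P.incidenceGraph))
        ≤ (2 : ℝ) ^ (δ * (F.vars.card : ℝ) + D) :=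
          Real.rpow_le_rpow_of_exponent_le (by norm_num) (hD _ L _ hL htd)
      _ = (2 : ℝ) ^ (δ * (F.vars.card : ℝ)) * 2 ^ D := Real.rpow_add (by norm_num) _ _
      _ ≤ _ := by gcongr
  have h₂ : ((p.eval P.atoms.card : ℕ) : ℝ) ≤ (p.eval (6 * w.length + 3) : ℕ) := by
    exact_mod_cast p.eval_mono_nat hcard
  have h₃ : (1 : ℝ) ≤ (2 : ℝ) ^ (δ * (F.vars.card : ℝ)) :=
    Real.one_le_rpow (by norm_num) (by positivity)
  have h₄ : ((t + (u.length + 1) : ℕ) : ℝ) ≤ (40000 * (w.length + 2) ^ 3 + 1 : ℕ) := by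
    exact_mod_cast (by omega : t + (u.length + 1) ≤ 40000 * (w.length + 2) ^ 3 + 1)
  have h₅ : (0 : ℝ) ≤ (40000 * (w.length + 2) ^ 3 + 1 : ℕ) := by positivity
  have e : ((40000 * (.X + 2) ^ 3 + 1 + .C N * p.comp (6 * .X + 3) : Polynomial ℕ).eval w.length) =
      40000 * (w.length + 2) ^ 3 + 1 + N * p.eval (6 * w.length + 3) := by
    simp [Polynomial.eval_comp]
  rw [e, Nat.cast_add (40000 * (w.length + 2) ^ 3 + 1), Nat.cast_mul N]
  have h₆ := mul_le_mul h₁ h₂ (by positivity) (by positivity)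
  -- The time of the translation may be multiplied by `2 ^ (δ * n) ≥ 1`.
  nlinarith [mul_le_mul_of_nonneg_right h₃ h₅]
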